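/- Let $(\Omega,\mathcal F,\mathbb P)$ be a probability space with a filtration $(\mathcal F_t)_{t\in[0,1]}$ that admits, for each $t\in[0,1)$, a regular conditional probability given $\mathcal F_t$; $\mathbb E[\,\cdot\,|\mathcal F_t]$ denotes the expectation under it. Let $W$ be a standard $k$-dimensional $(\mathcal F_t)$-Brownian motion on $[0,1]$ (for instance, with $(\mathcal F_t)$ generated by $W$). Let $\gamma,c\in[0,\infty)$ with $c+\gamma>0$, and for $a\ge 0$ put $$\mathcal U^{a}_t(F)=-\tfrac1a\log\mathbb E[e^{-aF}|\mathcal F_t]\quad(a>0),\qquad \mathcal U^{0}_t(F)=\mathbb E[F|\mathcal F_t],$$ and $\Pi_t=\mathcal U^{\gamma}_t$, $U_t=\mathcal U^{c}_t$, $U^*_t=\mathcal U^{c\gamma/(c+\gamma)}_t$. Let $s:\mathbb R^k\to\mathbb R^d$ and $g,h:\mathbb R^k\to\mathbb R$ be Borel, and let $S=s(W_1)$, $G=g(W_1)$, $H=h(W_1)$ have finite exponential moments of all orders: $\mathbb E[e^{a|F|}]<\infty$ for all $a>0$ and $F\in\{S,G,H\}$. Write $yS$ for the inner product of $y\in\mathbb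 R^d$ and $S$. The utility indifference price of the volume $y$ at time $t$ for a supplier with inventory $z$ is $$P_t(z,y)=\inf\{q\in\mathbb R:\ \Pi_t(G+zS-yS+q)\ge\Pi_t(G+zS)\}.$$ Let $A\subset\mathbb R^d$ be compact with $0\in A$. For $n\ge1$ define recursively, for $x\in\mathbb R$ and $z\in -A$, $V^n_t(x,z)=H+x-zS$ if $t\ge1$, and for $t\in[0,1)$, with $j=\lfloor nt\rfloor$, $$V^n_t(x,z)=\sup_{y\in A+z}U_{j/n}\Bigl(V^n_{(j+1)/n}\bigl(x-P_{j/n}(z,y),\,z-y\bigr)\Bigr).$$ For $t\in[0,1]$, $w\in\mathbb R^k$, $y\in\mathbb R^d$ let $v(t,w)$ and $p(t,w,y)$ be the exponential utilities with risk aversion $\frac{c\gamma}{c+\gamma}$, respectively $\gamma$, of $g(X)+h(X)$, respectively $g(X)-y\,s(X)$, where $X$ has the normal law $N(w,(1-t)I_k)$, the conditional law of $W_1$ given $W_t=w$. Thus, if $c,\gamma>0$, $$v(t,w)=-\tfrac{c+\gamma}{c\gamma}\log\mathbb E\bigl[e^{-\frac{c\gamma}{c+\gamma}(G+H)}\big|W_t=w\bigr],\qquad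 p(t,w,y)=-\tfrac1\gamma\log\mathbb E\bigl[e^{-\gamma(G-yS)}\big|W_t=w\bigr].$$ Assume that the derivatives $\partial_t$, $\partial_{w_i}$, $\partial_{w_i}\partial_{w_j}$ of $v$ exist and are bounded and uniformly continuous on $[0,1]\times\mathbb R^k$, and those of $p$ on $[0,1]\times\mathbb R^k\times A$ (one-sided $t$-derivatives at $t=0,1$). Assume the completeness condition: there is a measurable map $y^\dagger:\mathbb R^k\times[0,1]\times\mathbb R^k\to\mathbb R^d$ with $$-\nabla_w p\bigl(t,w,y^\dagger(w,t,z)\bigr)=z\qquad\text{for all }(z,t,w)\in\mathbb R^k\times[0,1]\times\mathbb R^k,$$ and assume that $A$ is large enough to contain the values of the optimal strategy: $$y^\dagger\bigl(w,t,-\tfrac{c}{c+\gamma}\nabla_w v(t,w)\bigr)\in A\qquad\text{for all }(t,w)\in[0,1]\times\mathbb R^k.$$ Then, almost surely, $$\lim_{n\to\infty}V^n_0(0,0)=v(0,W_0)-p(0,W_0,0)=U^*_0(G+H)-\Pi_0(G).$$ -/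

import Mathlib

open MeasureTheory ProbabilityTheory Filter Topology Set

noncomputable section

namespace IndifferencePricing

/-- `ℝ^n` with its Euclidean structure. -/
abbrev E (n : ℕ) : Type := EuclideanSpace ℝ (Fin n)

/-- Exponential utility (certainty equivalent) with risk aversion `a` under the law `μ`;
the value at `a = 0` is the limit as `a → 0`, the expectation. -/
def expUtility {α : Type*} [MeasurableSpace α] (a : ℝ) (μ : Measure α) (F : α → ℝ) : ℝ :=
  if a = 0 then ∫ x, F x ∂μ else -(1 / a) * Real.log (∫ x, Real.exp (-a * F x) ∂μ)

/-- The normal law `N(w, r I)` on `ℝ^k`: the law of a Brownian motion after time `r ≥ 0`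
when it starts at `w`. -/
def brownianKernel {k : ℕ} (r : ℝ) (w : E k) : Measure (E k) :=
  (stdGaussian (E k)).map (fun x => w + Real.sqrt r • x)

section Probability

variable {Ω : Type*} [mΩ : MeasurableSpace Ω]

/-- `W` is a standard `k`-dimensional `𝓕`-Brownian motion on the time interval `[0,1]`. Only the
restrictions of `𝓕` and `W` to `[0,1]` matter. -/
structure IsBrownianMotion {k : ℕ} (P : Measure Ω) (𝓕 : Filtration ℝ mΩ) (W : ℝ → Ω → E k) :
    Prop where
  adapted : ∀ t ∈ Icc (0 : ℝ) 1, Measurable[𝓕 t] (W t)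
  zero : ∀ᵐ ω ∂P, W 0 ω = 0
  indep : ∀ s t : ℝ, 0 ≤ s → s ≤ t → t ≤ 1 →
    Indep (MeasurableSpace.comap (fun ω => W t ω - W s ω) inferInstance) (𝓕 s) P
  law : ∀ s t : ℝ, 0 ≤ s → s ≤ t → t ≤ 1 →
    P.map (fun ω => W t ω - W s ω) = brownianKernel (t - s) 0
  continuous_paths : ∀ᵐ ω ∂P, ContinuousOn (fun t => W t ω) (Icc (0 : ℝ) 1)

/-- `κ t` is a regular conditional probability given `𝓕 t`, for each `t ∈ [0,1)`. -/
structure IsRegularCondProb (P : Measure Ω) (𝓕 : Filtration ℝ mΩ) (κ : ℝ → Ω → Measure Ω) :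
    Prop where
  isProbabilityMeasure : ∀ t ∈ Ico (0 : ℝ) 1, ∀ ω, IsProbabilityMeasure (κ t ω)
  measurable : ∀ t ∈ Ico (0 : ℝ) 1, ∀ B : Set Ω, MeasurableSet B →
    Measurable[𝓕 t] (fun ω => κ t ω B)
  condExp : ∀ t ∈ Ico (0 : ℝ) 1, ∀ B : Set Ω, MeasurableSet B →
    (fun ω => (κ t ω).real B) =ᵐ[P] P[B.indicator (fun _ => (1 : ℝ)) | 𝓕 t]

/-- All exponential moments of (the norm of) `F` are finite. -/
def HasExpMoments {V : Type*} [NormedAddCommGroup V] (P : Measure Ω) (F : Ω → V) : Prop :=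
  ∀ a : ℝ, 0 < a → Integrable (fun ω => Real.exp (a * ‖F ω‖)) P

/-- Conditional exponential utility at time `t` of the cash-flow `F`, expectations being taken
under the regular conditional probability. -/
def condUtility (κ : ℝ → Ω → Measure Ω) (a t : ℝ) (F : Ω → ℝ) (ω : Ω) : ℝ :=
  expUtility a (κ t ω) F

/-- Utility indifference price at time `t` of the volume `y`, quoted by the supplier with risk
aversion `γ` and endowment `G` when she holds `z` units of the securities `S`. -/
def price {d : ℕ} (κ : ℝ → Ω → Measure Ω) (γ : ℝ) (G : Ω → ℝ) (S : Ω → E d)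
    (t : ℝ) (z y : E d) (ω : Ω) : ℝ :=
  sInf {q : ℝ | condUtility κ γ t (fun ω' => G ω' + inner ℝ z (S ω')) ω ≤
    condUtility κ γ t (fun ω' => G ω' + inner ℝ z (S ω') - inner ℝ y (S ω') + q) ω}

/-- Dynamic programming value with `m` of the `n` trading dates left, i.e. at time `(n - m) / n`.
Here `x` is the cash of the demander (risk aversion `c`, endowment `H`) and `z ∈ -A` is the
inventory of the supplier, so the demander holds `-z`; after the demander buys `y ∈ A + z` the
inventory of the supplier is `z - y ∈ -A`. -/
def dpRemaining {d : ℕ} (κ : ℝ → Ω → Measure Ω) (γ c : ℝ) (A : Set (E d)) (G H : Ω → ℝ)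
    (S : Ω → E d) (n : ℕ) : ℕ → ℝ → E d → Ω → ℝ
  | 0, x, z, ω => H ω + x - inner ℝ z (S ω)
  | m + 1, x, z, ω =>
      sSup ((fun y : E d =>
        condUtility κ c (((n : ℝ) - ((m : ℝ) + 1)) / n)
          (fun ω' => dpRemaining κ γ c A G H S n m
            (x - price κ γ G S (((n : ℝ) - ((m : ℝ) + 1)) / n) z y ω') (z - y) ω') ω)
        '' {y : E d | y - z ∈ A})

/-- The value `V^n_t(x, z)`: terminal value `H + x - zS` for `t ≥ 1`, and for `t < 1` the supremum
over `y ∈ A + z` of `U_{j/n}(V^n_{(j+1)/n}(x - P_{j/n}(z, y), z - y))` with `j = ⌊n t⌋`. -/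
def dpValue {d : ℕ} (κ : ℝ → Ω → Measure Ω) (γ c : ℝ) (A : Set (E d)) (G H : Ω → ℝ)
    (S : Ω → E d) (n : ℕ) (t x : ℝ) (z : E d) (ω : Ω) : ℝ :=
  dpRemaining κ γ c A G H S n (n - ⌊(n : ℝ) * t⌋₊) x z ω

end Probability

section Markov

variable {k d : ℕ}

/-- `v(t, w)`: the exponential utility with risk aversion `cγ/(c+γ)` of `(g + h)(W_1)` given
`W_t = w`. -/
def vFun (γ c : ℝ) (g h : E k → ℝ) (t : ℝ) (w : E k) : ℝ :=
  expUtility (c * γ / (c + γ)) (brownianKernel (1 - t) w) (fun x => g x + h x)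

/-- `p(t, w, y)`: the exponential utility with risk aversion `γ` of `(g - y s)(W_1)` given
`W_t = w`. -/
def pFun (γ : ℝ) (g : E k → ℝ) (s : E k → E d) (t : ℝ) (w : E k) (y : E d) : ℝ :=
  expUtility γ (brownianKernel (1 - t) w) (fun x => g x - inner ℝ y (s x))

/-- The derivatives of `f (t, w, y)` of order one in `t` and of orders one and two in `w` exist and
are bounded and uniformly continuous on `[0,1] × ℝ^k × B` (one-sided in `t` at the end points). -/
structure HasRegularDerivs {Y : Type*} [UniformSpace Y] (B : Set Y) (f : ℝ → E k → Y → ℝ) :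
    Prop where
  differentiable_time : ∀ w : E k, ∀ y ∈ B, DifferentiableOn ℝ (fun t => f t w y) (Icc 0 1)
  contDiff_space : ∀ t ∈ Icc (0 : ℝ) 1, ∀ y ∈ B, ContDiff ℝ 2 (fun w => f t w y)
  bounded : ∃ C : ℝ, ∀ t ∈ Icc (0 : ℝ) 1, ∀ w : E k, ∀ y ∈ B,
    |derivWithin (fun t' => f t' w y) (Icc 0 1) t| ≤ C ∧
    ‖gradient (fun w' => f t w' y) w‖ ≤ C ∧
    ‖fderiv ℝ (gradient (fun w' => f t w' y)) w‖ ≤ C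
  uniform_time : UniformContinuousOn
    (fun q : ℝ × E k × Y => derivWithin (fun t' => f t' q.2.1 q.2.2) (Icc 0 1) q.1)
    (Icc 0 1 ×ˢ univ ×ˢ B)
  uniform_gradient : UniformContinuousOn
    (fun q : ℝ × E k × Y => gradient (fun w' => f q.1 w' q.2.2) q.2.1)
    (Icc 0 1 ×ˢ univ ×ˢ B)
  uniform_hessian : UniformContinuousOn
    (fun q : ℝ × E k × Y => fderiv ℝ (gradient (fun w' => f q.1 w' q.2.2)) q.2.1)
    (Icc 0 1 ×ˢ univ ×ˢ B)

/-- Completeness condition: `yd` is measurable and `-∇p(t, w, yd(w, t, z)) = z` for all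
`(z, t, w) ∈ ℝ^k × [0,1] × ℝ^k`, where `∇` is the gradient in `w`. -/
structure IsCompletenessMap (γ : ℝ) (g : E k → ℝ) (s : E k → E d)
    (yd : E k × ℝ × E k → E d) : Prop where
  measurable : Measurable yd
  hasGradientAt : ∀ z : E k, ∀ t ∈ Icc (0 : ℝ) 1, ∀ w : E k,
    HasGradientAt (fun w' => pFun γ g s t w' (yd (w, t, z))) (-z) w

end Markov

end IndifferencePricing

end

/-! If the continuation value `V` of a trading period is split into `F` for the supplier and
`V - F` for the demander, then, as risk tolerances add up, the sum of their utilities is at most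
the utility of `V` with risk aversion `cγ/(c+γ)`, with equality when `F` is `θ V`, `θ = c/(c+γ)`,
up to a constant. For `F = θ V + R` the loss is at most a tilted second moment of `R` about a
constant, which is of order `δ |∇R|²` over a period of length `δ`. Here `V = v(t', ·)` and
`F = p(t', ·, u)`, and completeness provides a position `u` with `∇p = θ ∇v` at the current time
and state, so that uniform continuity of the gradients makes the loss `o(δ)` uniformly in time and
state. Since one step of dynamic programming is monotone and commutes with adding constants, the
losses of `n` periods of length `1/n` add up to `o(1)`. -/

namespace IndifferencePricing

section ExpIntegrable

variable {α : Type*} [MeasurableSpace α] {μ : Measure α} {F G : α → ℝ}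

/-- The moment generating function of the real function `F` is finite everywhere. In contrast to
`HasExpMoments` this concerns the signed function, and it provides the measurability of `F`. -/
def ExpIntegrable (μ : Measure α) (F : α → ℝ) : Prop :=
  ∀ b : ℝ, Integrable (fun x => Real.exp (b * F x)) μ

lemma expIntegrable_const [IsFiniteMeasure μ] (r : ℝ) : ExpIntegrable μ (fun _ => r) :=
  fun _ => integrable_const _

namespace ExpIntegrable

lemma aemeasurable (hF : ExpIntegrable μ F) : AEMeasurable F μ :=
  aemeasurable_of_integrable_exp_mul zero_ne_one (hF 0) (hF 1)

lemma integrable (hF : ExpIntegrable μ F) : Integrable F μ := by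
  simpa only [pow_one] using integrable_pow_of_integrable_exp_mul one_ne_zero (hF 1) (hF (-1)) 1

lemma sq_mul_exp_abs (hF : ExpIntegrable μ F) {b : ℝ} (hb : 0 ≤ b) :
    Integrable (fun x => F x ^ 2 * Real.exp (b * |F x|)) μ := by
  have hb' : b < |b + 1| := (lt_add_one b).trans_le (le_abs_self _)
  simpa only [sq_abs, zero_mul, zero_add] using
    integrable_pow_abs_mul_exp_add_of_integrable_exp_mul (v := 0) (hF _) (hF _) hb hb' 2

lemma memLp_two_exp (hF : ExpIntegrable μ F) (b : ℝ) :
    MemLp (fun x => Real.exp (b * F x)) 2 μ := by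
  rw [memLp_two_iff_integrable_sq (hF b).aestronglyMeasurable]
  refine (hF (2 * b)).congr (ae_of_all _ fun x => ?_)
  dsimp only
  rw [← Real.exp_nat_mul, Nat.cast_ofNat, mul_assoc]

lemma add (hF : ExpIntegrable μ F) (hG : ExpIntegrable μ G) :
    ExpIntegrable μ (fun x => F x + G x) := fun b => by
  simp only [mul_add, Real.exp_add]
  exact (hF.memLp_two_exp b).integrable_mul (hG.memLp_two_exp b)

lemma const_mul (hF : ExpIntegrable μ F) (r : ℝ) : ExpIntegrable μ (fun x => r * F x) :=
  fun b => by simpa only [mul_assoc] using hF (b * r)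

lemma neg (hF : ExpIntegrable μ F) : ExpIntegrable μ (fun x => -F x) := by
  simpa only [neg_one_mul] using hF.const_mul (-1)

lemma sub (hF : ExpIntegrable μ F) (hG : ExpIntegrable μ G) :
    ExpIntegrable μ (fun x => F x - G x) := by
  simpa only [sub_eq_add_neg] using hF.add hG.neg

lemma tilted (hF : ExpIntegrable μ F) (hG : ExpIntegrable μ G) (a : ℝ) :
    ExpIntegrable (μ.tilted (fun x => a * G x)) F := fun b => by
  rw [integrable_tilted_iff (hG a)]
  simpa only [one_mul, smul_eq_mul, Real.exp_add] using ((hG.const_mul a).add (hF.const_mul b)) 1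

end ExpIntegrable

end ExpIntegrable

section ExpUtility

variable {α β : Type*} [MeasurableSpace α] [MeasurableSpace β] {μ : Measure α} {F G V R : α → ℝ}
  {a b r : ℝ}

lemma expUtility_zero (μ : Measure α) (F : α → ℝ) : expUtility 0 μ F = ∫ x, F x ∂μ :=
  if_pos rfl

lemma expUtility_of_ne_zero (ha : a ≠ 0) (μ : Measure α) (F : α → ℝ) :
    expUtility a μ F = -(1 / a) * cgf F μ (-a) :=
  if_neg ha

lemma expUtility_map {X : α → β} {f : β → ℝ} (a : ℝ) (hX : AEMeasurable X μ)
    (hf : AEMeasurable f (μ.map X)) :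
    expUtility a (μ.map X) f = expUtility a μ (fun x => f (X x)) := by
  unfold expUtility
  rw [integral_map hX hf.aestronglyMeasurable,
    integral_map hX (hf.const_mul (-a)).exp.aestronglyMeasurable]

lemma expUtility_congr (a : ℝ) (h : F =ᵐ[μ] G) : expUtility a μ F = expUtility a μ G := by
  rcases eq_or_ne a 0 with rfl | ha
  · simp only [expUtility_zero, integral_congr_ae h]
  · simp only [expUtility_of_ne_zero ha, cgf, mgf_congr h]

lemma expUtility_dirac [MeasurableSingletonClass α] (a : ℝ) (x : α) (F : α → ℝ) :
    expUtility a (Measure.dirac x) F = F x := by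
  rcases eq_or_ne a 0 with rfl | ha
  · rw [expUtility_zero, integral_dirac]
  · rw [expUtility_of_ne_zero ha, cgf, mgf_dirac', Real.log_exp]
    field_simp

variable [IsProbabilityMeasure μ]

lemma expUtility_add_const (a r : ℝ) (hF : ExpIntegrable μ F) :
    expUtility a μ (fun x => F x + r) = expUtility a μ F + r := by
  rcases eq_or_ne a 0 with rfl | ha
  · simp [expUtility_zero, integral_add hF.integrable (integrable_const r)]
  · rw [expUtility_of_ne_zero ha, expUtility_of_ne_zero ha, cgf, mgf_add_const,
      Real.log_mul (mgf_pos (hF (-a))).ne' (Real.exp_ne_zero _), Real.log_exp, cgf]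
    field_simp
    ring

lemma expUtility_mono (ha : 0 ≤ a) (hF : ExpIntegrable μ F) (hG : ExpIntegrable μ G)
    (h : ∀ x, F x ≤ G x) : expUtility a μ F ≤ expUtility a μ G := by
  rcases ha.eq_or_lt' with rfl | ha
  · simpa only [expUtility_zero] using integral_mono hF.integrable hG.integrable h
  · simp only [expUtility_of_ne_zero ha.ne', neg_mul, neg_le_neg_iff]
    have hmgf := mgf_anti_of_nonpos (ae_of_all μ h) (neg_nonpos.2 ha.le) (hF (-a))
    exact mul_le_mul_of_nonneg_left (Real.log_le_log (mgf_pos (hG _)) hmgf) (by positivity)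

lemma expUtility_le_add_of_le (ha : 0 ≤ a) (hF : ExpIntegrable μ F) (hG : ExpIntegrable μ G)
    (h : ∀ x, F x ≤ G x + r) : expUtility a μ F ≤ expUtility a μ G + r := by
  rw [← expUtility_add_const a r hG]
  exact expUtility_mono ha hF (hG.add (expIntegrable_const r)) h

lemma mgf_mul_add_eq_mgf_mul_mgf_tilted (b θ : ℝ) (hV : ExpIntegrable μ V) :
    mgf (fun x => θ * V x + R x) μ (-b) =
      mgf V μ (-(b * θ)) * mgf R (μ.tilted fun x => -(b * θ) * V x) (-b) := by
  simp only [mgf]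
  rw [integral_exp_tilted, mul_div_cancel₀ _ (integral_exp_pos (hV _)).ne']
  congr 1 with x
  simp only [Pi.add_apply]
  ring_nf

lemma expUtility_mul_add (b θ : ℝ) (hV : ExpIntegrable μ V) (hR : ExpIntegrable μ R) :
    expUtility b μ (fun x => θ * V x + R x) =
      θ * expUtility (b * θ) μ V + expUtility b (μ.tilted fun x => -(b * θ) * V x) R := by
  have := isProbabilityMeasure_tilted (hV (-(b * θ)))
  rcases eq_or_ne b 0 with rfl | hb
  · simp only [zero_mul, neg_zero, tilted_const, expUtility_zero]
    rw [integral_add (hV.integrable.const_mul θ) hR.integrable, integral_const_mul]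
  · simp only [expUtility_of_ne_zero hb]
    rw [cgf, mgf_mul_add_eq_mgf_mul_mgf_tilted b θ hV, Real.log_mul (mgf_pos (hV _)).ne'
      (mgf_pos (hR.tilted hV _ _)).ne']
    rcases eq_or_ne θ 0 with rfl | hθ
    · simp [cgf]
    · rw [expUtility_of_ne_zero (mul_ne_zero hb hθ), cgf, cgf]
      field_simp
      ring

lemma expUtility_le_integral (hb : 0 ≤ b) (hR : ExpIntegrable μ R) :
    expUtility b μ R ≤ ∫ x, R x ∂μ := by
  rcases hb.eq_or_lt' with rfl | hb
  · rw [expUtility_zero]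
  have jensen : Real.exp (-b * ∫ x, R x ∂μ) ≤ mgf R μ (-b) := by
    rw [← integral_const_mul]
    exact convexOn_exp.map_integral_le Real.continuous_exp.continuousOn isClosed_univ
      (ae_of_all _ fun _ => mem_univ _) (hR.integrable.const_mul _) (hR (-b))
  have hcgf : -b * ∫ x, R x ∂μ ≤ cgf R μ (-b) := (Real.le_log_iff_exp_le (mgf_pos (hR _))).2 jensen
  rw [expUtility_of_ne_zero hb.ne', neg_mul, one_div_mul_eq_div, neg_le, le_div_iff₀ hb]
  linarith

lemma exp_le_one_add_add_sq_mul_exp_abs (x : ℝ) :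
    Real.exp x ≤ 1 + x + x ^ 2 * Real.exp |x| := by
  have h := Complex.norm_exp_sub_sum_le_norm_mul_exp (x : ℂ) 2
  simp only [Finset.sum_range_succ, Finset.range_zero, Finset.sum_empty] at h
  rw [← Complex.ofReal_exp] at h
  norm_num at h
  norm_cast at h
  linarith [(abs_le.1 h).2]

lemma cgf_neg_le (hb : 0 ≤ b) (hR : ExpIntegrable μ R) :
    cgf R μ (-b) ≤ -b * ∫ x, R x ∂μ + b ^ 2 * ∫ x, R x ^ 2 * Real.exp (b * |R x|) ∂μ := by
  have hlin : Integrable (fun x => 1 + -b * R x) μ :=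
    (integrable_const _).add (hR.integrable.const_mul _)
  have hsq := (hR.sq_mul_exp_abs hb).const_mul (b ^ 2)
  have hmgf : mgf R μ (-b) ≤
      ∫ x, (1 + (-b) * R x + b ^ 2 * (R x ^ 2 * Real.exp (b * |R x|))) ∂μ := by
    refine integral_mono (hR _) (hlin.add hsq) fun x => ?_
    have h := exp_le_one_add_add_sq_mul_exp_abs (-b * R x)
    rwa [abs_mul, abs_neg, abs_of_nonneg hb, mul_pow, neg_sq, mul_assoc (b ^ 2)] at h
  rw [integral_add hlin hsq, integral_add (integrable_const _) (hR.integrable.const_mul _),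
    integral_const_mul, integral_const_mul, integral_const, probReal_univ, one_smul] at hmgf
  have hlog := Real.log_le_sub_one_of_pos (mgf_pos (hR (-b)))
  rw [cgf]
  linarith

lemma integral_sub_le_expUtility (hb : 0 ≤ b) (hR : ExpIntegrable μ R) :
    ∫ x, R x ∂μ - b * ∫ x, R x ^ 2 * Real.exp (b * |R x|) ∂μ ≤ expUtility b μ R := by
  have hcgf := cgf_neg_le hb hR
  rcases hb.eq_or_lt' with rfl | hb
  · simp [expUtility_zero]
  · rw [expUtility_of_ne_zero hb.ne', neg_mul, one_div_mul_eq_div, le_neg, div_le_iff₀ hb]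
    linarith

end ExpUtility

section RiskSharing

variable {α : Type*} [MeasurableSpace α] {μ : Measure α} [IsProbabilityMeasure μ] {F V R : α → ℝ}
  {γ c : ℝ}

/-- The sum of the exponential utilities of two agents with risk aversions `γ` and `c` who share
the cash-flow `V` such that the first one receives `F`. -/
noncomputable def aggregateUtility (γ c : ℝ) (μ : Measure α) (V F : α → ℝ) : ℝ :=
  expUtility γ μ F + expUtility c μ (fun x => V x - F x)

lemma aggregateUtility_add_const (γ c r : ℝ) (hV : ExpIntegrable μ V) (hF : ExpIntegrable μ F) :
    aggregateUtility γ c μ V (fun x => F x + r) = aggregateUtility γ c μ V F := by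
  simp only [aggregateUtility, ← sub_sub, sub_eq_add_neg (_ - _) r]
  rw [expUtility_add_const γ r hF, expUtility_add_const c (-r) (hV.sub hF)]
  ring

lemma aggregateUtility_mul_add (hcγ : c + γ ≠ 0) (hV : ExpIntegrable μ V)
    (hR : ExpIntegrable μ R) :
    aggregateUtility γ c μ V (fun x => c / (c + γ) * V x + R x) =
      expUtility (c * γ / (c + γ)) μ V +
        aggregateUtility γ c (μ.tilted fun x => -(c * γ / (c + γ)) * V x) (fun _ => 0) R := by
  have hsupplier := expUtility_mul_add γ (c / (c + γ)) hV hR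
  have hdemander := expUtility_mul_add c (γ / (c + γ)) hV hR.neg
  have hrest : (fun x => V x - (c / (c + γ) * V x + R x)) =
      fun x => γ / (c + γ) * V x + -R x := by
    funext x
    field_simp
    ring
  have hshares : c / (c + γ) + γ / (c + γ) = 1 := by field_simp
  simp only [aggregateUtility, zero_sub]
  rw [hrest, hsupplier, hdemander, show γ * (c / (c + γ)) = c * γ / (c + γ) by ring,
    show c * (γ / (c + γ)) = c * γ / (c + γ) by ring]
  linear_combination expUtility (c * γ / (c + γ)) μ V * hshares

lemma aggregateUtility_zero_nonpos (hγ : 0 ≤ γ) (hc : 0 ≤ c) (hR : ExpIntegrable μ R) :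
    aggregateUtility γ c μ (fun _ => 0) R ≤ 0 := by
  have hsupplier := expUtility_le_integral hγ hR
  have hdemander := expUtility_le_integral hc hR.neg
  rw [integral_neg] at hdemander
  simp only [aggregateUtility, zero_sub]
  linarith

lemma neg_le_aggregateUtility_zero (hγ : 0 ≤ γ) (hc : 0 ≤ c) (hR : ExpIntegrable μ R) :
    -((c + γ) * ∫ x, R x ^ 2 * Real.exp ((c + γ) * |R x|) ∂μ) ≤
      aggregateUtility γ c μ (fun _ => 0) R := by
  have hsupplier := integral_sub_le_expUtility hγ hR
  have hdemander := integral_sub_le_expUtility hc hR.neg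
  simp only [integral_neg, neg_sq, abs_neg] at hdemander
  have hmono : ∀ b, 0 ≤ b → b ≤ c + γ → b * ∫ x, R x ^ 2 * Real.exp (b * |R x|) ∂μ ≤
      b * ∫ x, R x ^ 2 * Real.exp ((c + γ) * |R x|) ∂μ := fun b hb hbcγ =>
    mul_le_mul_of_nonneg_left (integral_mono (hR.sq_mul_exp_abs hb)
      (hR.sq_mul_exp_abs (hb.trans hbcγ)) fun x => by dsimp only; gcongr) hb
  have hγcγ := hmono γ hγ (by linarith)
  have hccγ := hmono c hc (by linarith)
  simp only [aggregateUtility, zero_sub]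
  linarith

lemma aggregateUtility_le (hγ : 0 ≤ γ) (hc : 0 ≤ c) (hcγ : 0 < c + γ) (hV : ExpIntegrable μ V)
    (hF : ExpIntegrable μ F) :
    aggregateUtility γ c μ V F ≤ expUtility (c * γ / (c + γ)) μ V := by
  have hR : ExpIntegrable μ (fun x => F x - c / (c + γ) * V x) := hF.sub (hV.const_mul _)
  have := isProbabilityMeasure_tilted (hV (-(c * γ / (c + γ))))
  have hshare := aggregateUtility_mul_add hcγ.ne' hV hR
  simp only [add_sub_cancel] at hshare
  linarith [aggregateUtility_zero_nonpos hγ hc (hR.tilted hV (-(c * γ / (c + γ))))]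

lemma sub_le_aggregateUtility (hγ : 0 ≤ γ) (hc : 0 ≤ c) (hcγ : 0 < c + γ)
    (hV : ExpIntegrable μ V) (hR : ExpIntegrable μ R) {r : ℝ}
    (hF : ∀ x, F x = c / (c + γ) * V x + R x + r) :
    expUtility (c * γ / (c + γ)) μ V - (c + γ) * ∫ x, R x ^ 2 * Real.exp ((c + γ) * |R x|)
        ∂(μ.tilted fun x => -(c * γ / (c + γ)) * V x) ≤ aggregateUtility γ c μ V F := by
  have := isProbabilityMeasure_tilted (hV (-(c * γ / (c + γ))))
  rw [funext hF, aggregateUtility_add_const γ c r hV ((hV.const_mul _).add hR),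
    aggregateUtility_mul_add hcγ.ne' hV hR]
  linarith [neg_le_aggregateUtility_zero hγ hc (hR.tilted hV (-(c * γ / (c + γ))))]

end RiskSharing

section Tilting

variable {α β : Type*} [MeasurableSpace α] [MeasurableSpace β] {μ : Measure α}

lemma integral_tilted_map {X : α → β} {T f : β → ℝ} (hX : AEMeasurable X μ)
    (hT : AEMeasurable T (μ.map X)) (hf : AEMeasurable f (μ.map X)) :
    ∫ y, f y ∂((μ.map X).tilted T) = ∫ x, f (X x) ∂(μ.tilted fun x => T (X x)) := by
  rw [integral_tilted, integral_tilted, integral_map hX hT.exp.aestronglyMeasurable]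
  exact integral_map hX ((hT.exp.div_const _).smul hf).aestronglyMeasurable

lemma integral_tilted_le [NeZero μ] {T Λ φ ψ : α → ℝ} {r : ℝ} (hT : ∀ x, |T x - r| ≤ Λ x)
    (hφ : ∀ x, 0 ≤ φ x) (hφψ : ∀ x, φ x ≤ ψ x) (hTint : Integrable (fun x => Real.exp (T x)) μ)
    (hΛ : Integrable (fun x => Real.exp (-Λ x)) μ)
    (hψ : Integrable (fun x => Real.exp (Λ x) * ψ x) μ) :
    ∫ x, φ x ∂(μ.tilted T) ≤
      (∫ x, Real.exp (Λ x) * ψ x ∂μ) / ∫ x, Real.exp (-Λ x) ∂μ := by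
  have hZpos : 0 < ∫ x, Real.exp (-Λ x) ∂μ := integral_exp_pos hΛ
  have hZ : Real.exp r * ∫ x, Real.exp (-Λ x) ∂μ ≤ ∫ x, Real.exp (T x) ∂μ := by
    rw [← integral_const_mul]
    refine integral_mono (hΛ.const_mul _) hTint fun x => ?_
    dsimp only
    rw [← Real.exp_add, Real.exp_le_exp]
    linarith [(abs_le.1 (hT x)).1]
  have hweight : ∀ x, Real.exp (T x) / ∫ x, Real.exp (T x) ∂μ ≤
      Real.exp (Λ x) / ∫ x, Real.exp (-Λ x) ∂μ := fun x => by
    have hTx : Real.exp (T x) ≤ Real.exp r * Real.exp (Λ x) := by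
      rw [← Real.exp_add, Real.exp_le_exp]
      linarith [(abs_le.1 (hT x)).2]
    calc Real.exp (T x) / ∫ x, Real.exp (T x) ∂μ
        ≤ Real.exp r * Real.exp (Λ x) / (Real.exp r * ∫ x, Real.exp (-Λ x) ∂μ) := by gcongr
      _ = _ := mul_div_mul_left _ _ (Real.exp_ne_zero r)
  rw [integral_tilted, ← integral_div]
  refine integral_mono_of_nonneg (ae_of_all _ fun x => ?_) (hψ.div_const _)
    (ae_of_all _ fun x => ?_)
  · exact smul_nonneg (div_nonneg (Real.exp_pos _).le (integral_exp_pos hTint).le) (hφ x)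
  · dsimp only
    rw [smul_eq_mul, mul_div_right_comm]
    exact mul_le_mul (hweight x) (hφψ x) (hφ x) (div_nonneg (Real.exp_pos _).le hZpos.le)

end Tilting

section Gaussian

variable {X : Type*} [NormedAddCommGroup X] [NormedSpace ℝ X] [CompleteSpace X]
  [SecondCountableTopology X] [MeasurableSpace X] [BorelSpace X]

lemma integrable_exp_mul_norm (μ : Measure X) [IsGaussian μ] (b : ℝ) :
    Integrable (fun x => Real.exp (b * ‖x‖)) μ := by
  obtain ⟨C, hC, hint⟩ := IsGaussian.exists_integrable_exp_sq μ
  refine (hint.const_mul (Real.exp (b ^ 2 / (4 * C)))).mono' (by fun_prop)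
    (ae_of_all _ fun x => ?_)
  have hsquare : b ^ 2 / (4 * C) + C * ‖x‖ ^ 2 - b * ‖x‖ = (b - 2 * C * ‖x‖) ^ 2 / (4 * C) := by
    field_simp
    ring
  have hnonneg : 0 ≤ (b - 2 * C * ‖x‖) ^ 2 / (4 * C) := by positivity
  rw [Real.norm_of_nonneg (Real.exp_pos _).le, ← Real.exp_add, Real.exp_le_exp]
  linarith

lemma expIntegrable_of_lipschitzWith (μ : Measure X) [IsGaussian μ] {f : X → ℝ} {L : NNReal}
    (hf : LipschitzWith L f) : ExpIntegrable μ f := fun b => by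
  have hf' := hf.continuous
  refine ((integrable_exp_mul_norm μ (|b| * L)).const_mul (Real.exp (b * f 0))).mono'
    (by fun_prop) (ae_of_all _ fun x => ?_)
  have hLip : |f x - f 0| ≤ L * ‖x‖ := by simpa [Real.dist_eq] using hf.dist_le_mul x 0
  rw [Real.norm_of_nonneg (Real.exp_pos _).le, ← Real.exp_add, Real.exp_le_exp]
  calc b * f x = b * f 0 + b * (f x - f 0) := by ring
    _ ≤ b * f 0 + |b| * |f x - f 0| := by
      rw [← abs_mul]
      gcongr
      exact le_abs_self _
    _ ≤ b * f 0 + |b| * L * ‖x‖ := by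
      rw [mul_assoc]
      gcongr

end Gaussian

section BrownianKernel

variable {k : ℕ} {f : E k → ℝ} {L : NNReal} {a r δ : ℝ}

instance isGaussian_brownianKernel (r : ℝ) (w : E k) : IsGaussian (brownianKernel r w) := by
  have hscale : IsGaussian ((stdGaussian (E k)).map fun x => Real.sqrt r • x) :=
    isGaussian_map (Real.sqrt r • ContinuousLinearMap.id ℝ (E k))
  have hshift : brownianKernel r w =
      ((stdGaussian (E k)).map fun x => Real.sqrt r • x).map fun x => w + x := by
    rw [Measure.map_map (by fun_prop) (by fun_prop)]
    rfl
  rw [hshift]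
  infer_instance

lemma brownianKernel_zero (w : E k) : brownianKernel 0 w = Measure.dirac w := by
  simp [brownianKernel, Measure.map_const]

lemma map_const_add_brownianKernel (r : ℝ) (w x : E k) :
    (brownianKernel r x).map (fun y => w + y) = brownianKernel r (w + x) := by
  rw [brownianKernel, Measure.map_map (by fun_prop) (by fun_prop)]
  simp only [Function.comp_def, ← add_assoc]
  rfl

lemma charFun_brownianKernel (hr : 0 ≤ r) (w t : E k) :
    charFun (brownianKernel r w) t =
      Complex.exp (-(r * ‖t‖ ^ 2 / 2 : ℝ)) * Complex.exp (inner ℝ w t * Complex.I) := by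
  have hshift : brownianKernel r w =
      ((stdGaussian (E k)).map (fun x => Real.sqrt r • x)).map (fun x => w + x) := by
    rw [Measure.map_map (by fun_prop) (by fun_prop)]
    rfl
  have hexponent : -((|Real.sqrt r| * ‖t‖ : ℝ) : ℂ) ^ 2 / 2 = -(r * ‖t‖ ^ 2 / 2 : ℝ) := by
    norm_cast
    rw [mul_pow, sq_abs, Real.sq_sqrt hr]
    ring
  rw [hshift, charFun_map_const_add, charFun_map_smul, charFun_stdGaussian, norm_smul,
    Real.norm_eq_abs, hexponent]

lemma brownianKernel_conv (hδ : 0 ≤ δ) (hr : 0 ≤ r) (w : E k) :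
    brownianKernel δ w ∗ brownianKernel r 0 = brownianKernel (δ + r) w := by
  refine Measure.ext_of_charFun (funext fun t => ?_)
  rw [charFun_conv, charFun_brownianKernel hδ, charFun_brownianKernel hr,
    charFun_brownianKernel (add_nonneg hδ hr), inner_zero_left, Complex.ofReal_zero, zero_mul,
    Complex.exp_zero, mul_one, mul_right_comm, ← Complex.exp_add]
  congr 2
  push_cast
  ring

lemma integral_integral_brownianKernel (hδ : 0 ≤ δ) (hr : 0 ≤ r) {w : E k}
    (hf : Measurable f) (hi : Integrable f (brownianKernel (δ + r) w)) :
    ∫ x, ∫ y, f y ∂(brownianKernel r x) ∂(brownianKernel δ w) =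
      ∫ y, f y ∂(brownianKernel (δ + r) w) := by
  rw [← brownianKernel_conv hδ hr] at hi ⊢
  rw [integral_conv hi]
  congr 1 with x
  rw [← integral_map (φ := fun y => x + y) (by fun_prop) hf.aestronglyMeasurable,
    map_const_add_brownianKernel, add_zero]

lemma expUtility_expUtility_brownianKernel (a : ℝ) (hδ : 0 ≤ δ) (hr : 0 ≤ r) (w : E k)
    (hf : LipschitzWith L f) :
    expUtility a (brownianKernel δ w) (fun x => expUtility a (brownianKernel r x) f) =
      expUtility a (brownianKernel (δ + r) w) f := by
  have hm : Measurable f := hf.continuous.measurable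
  have hexp : ∀ r (x : E k), ExpIntegrable (brownianKernel r x) f :=
    fun r x => expIntegrable_of_lipschitzWith _ hf
  by_cases ha : a = 0
  · simp only [expUtility, ha, if_true]
    exact integral_integral_brownianKernel hδ hr hm (hexp _ w).integrable
  · simp only [expUtility, ha, if_false]
    rw [← integral_integral_brownianKernel hδ hr (hm.const_mul (-a)).exp (hexp _ w (-a))]
    congr 3 with x
    rw [← mul_assoc, show -a * -(1 / a) = 1 by field_simp, one_mul,
      Real.exp_log (integral_exp_pos (hexp r x (-a)))]

lemma lipschitzWith_expUtility_brownianKernel (ha : 0 ≤ a) (r : ℝ) (hf : LipschitzWith L f) :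
    LipschitzWith L (fun w => expUtility a (brownianKernel r w) f) := by
  have hshift : ∀ w : E k,
      LipschitzWith (L * (0 + ‖Real.sqrt r‖₊)) fun x => f (w + Real.sqrt r • x) := fun w =>
    hf.comp ((LipschitzWith.const w).add (lipschitzWith_smul (Real.sqrt r)))
  refine LipschitzWith.of_le_add_mul L fun w w' => ?_
  rw [brownianKernel, brownianKernel, expUtility_map a (by fun_prop) hf.continuous.aemeasurable,
    expUtility_map a (by fun_prop) hf.continuous.aemeasurable]
  refine expUtility_le_add_of_le ha (expIntegrable_of_lipschitzWith _ (hshift w))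
    (expIntegrable_of_lipschitzWith _ (hshift w')) fun x => ?_
  have hLip := hf.dist_le_mul (w + Real.sqrt r • x) (w' + Real.sqrt r • x)
  rw [dist_add_right, Real.dist_eq] at hLip
  linarith [(abs_le.1 hLip).2]

lemma sq_mul_exp_abs_le {x ε B M b σ ρ : ℝ} (hε : 0 ≤ ε) (hB : 0 ≤ B) (hM : 0 ≤ M) (hb : 0 ≤ b)
    (hσ : 0 ≤ σ) (hσ1 : σ ≤ 1) (hρ : 0 ≤ ρ) (hlin : |x| ≤ M * (σ * ρ))
    (hquad : |x| ≤ (ε + B * (σ * ρ)) * (σ * ρ)) :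
    x ^ 2 * Real.exp (b * |x|) ≤ σ ^ 2 * (ε + B * σ) ^ 2 * Real.exp ((b * M + 4) * ρ) := by
  have hexp : (1 + ρ) * ρ ≤ Real.exp (2 * ρ) := by
    rw [two_mul, Real.exp_add]
    gcongr <;> linarith [Real.add_one_le_exp ρ]
  have habs : |x| ≤ σ * (ε + B * σ) * Real.exp (2 * ρ) := by
    calc |x| ≤ (ε + B * (σ * ρ)) * (σ * ρ) := hquad
      _ ≤ (ε + B * σ) * (1 + ρ) * (σ * ρ) := by
        gcongr
        nlinarith [mul_nonneg hε hρ, mul_nonneg hB hσ]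
      _ = σ * (ε + B * σ) * ((1 + ρ) * ρ) := by ring
      _ ≤ σ * (ε + B * σ) * Real.exp (2 * ρ) := by gcongr
  have hweight : b * |x| ≤ b * M * ρ := by
    rw [mul_assoc]
    gcongr
    exact hlin.trans (by gcongr; exact mul_le_of_le_one_left hρ hσ1)
  calc x ^ 2 * Real.exp (b * |x|)
      ≤ (σ * (ε + B * σ) * Real.exp (2 * ρ)) ^ 2 * Real.exp (b * M * ρ) := by
        rw [← sq_abs x]
        gcongr
    _ = σ ^ 2 * (ε + B * σ) ^ 2 * Real.exp ((b * M + 4) * ρ) := by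
        rw [mul_pow, mul_pow, ← Real.exp_nat_mul, mul_assoc, ← Real.exp_add]
        push_cast
        ring_nf

lemma integral_tilted_brownianKernel_le {V R : E k → ℝ} {w : E k} {M : NNReal} {b ε B : ℝ}
    (ha : 0 ≤ a) (hb : 0 ≤ b) (hε : 0 ≤ ε) (hB : 0 ≤ B) (hδ : 0 ≤ δ) (hδ1 : δ ≤ 1)
    (hV : LipschitzWith L V) (hR : Measurable R) (hlin : ∀ x, |R x| ≤ M * ‖x - w‖)
    (hquad : ∀ x, |R x| ≤ (ε + B * ‖x - w‖) * ‖x - w‖) :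
    ∫ x, R x ^ 2 * Real.exp (b * |R x|) ∂((brownianKernel δ w).tilted fun x => -a * V x) ≤
      (∫ x : E k, Real.exp ((a * L + b * M + 4) * ‖x‖) ∂stdGaussian (E k)) /
        (∫ x : E k, Real.exp (-(a * L) * ‖x‖) ∂stdGaussian (E k)) *
        (δ * (ε + B * Real.sqrt δ) ^ 2) := by
  have hσ := Real.sqrt_nonneg δ
  have hσ1 : Real.sqrt δ ≤ 1 := Real.sqrt_le_one.2 hδ1
  have hnorm : ∀ x : E k, ‖w + Real.sqrt δ • x - w‖ = Real.sqrt δ * ‖x‖ := fun x => by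
    rw [add_sub_cancel_left, norm_smul, Real.norm_of_nonneg hσ]
  have hVc := hV.continuous
  have hexp : ∀ m : ℝ, Integrable (fun x : E k => Real.exp (m * ‖x‖)) (stdGaussian (E k)) :=
    integrable_exp_mul_norm _
  have hmul : ∀ x : E k, Real.exp (a * L * ‖x‖) * (Real.sqrt δ ^ 2 * (ε + B * Real.sqrt δ) ^ 2 *
      Real.exp ((b * M + 4) * ‖x‖)) =
      Real.exp ((a * L + b * M + 4) * ‖x‖) * (δ * (ε + B * Real.sqrt δ) ^ 2) := fun x => by
    rw [Real.sq_sqrt hδ, mul_left_comm, ← Real.exp_add, mul_comm]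
    ring_nf
  rw [div_mul_eq_mul_div, ← integral_mul_const, brownianKernel,
    integral_tilted_map (by fun_prop) (by fun_prop) (by fun_prop)]
  simp only [← hmul, neg_mul]
  refine integral_tilted_le (r := -(a * V w)) (fun x => ?_) (fun x => by positivity) (fun x => ?_)
    ?_ (by simpa only [neg_mul] using hexp (-(a * L))) ?_
  · have hLip := hV.dist_le_mul (w + Real.sqrt δ • x) w
    rw [dist_eq_norm, dist_eq_norm, hnorm, Real.norm_eq_abs] at hLip
    rw [neg_sub_neg, ← mul_sub, abs_mul, abs_of_nonneg ha, abs_sub_comm, mul_assoc]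
    gcongr
    exact hLip.trans (by gcongr; exact mul_le_of_le_one_left (norm_nonneg x) hσ1)
  · exact sq_mul_exp_abs_le hε hB M.2 hb hσ hσ1 (norm_nonneg x) (hnorm x ▸ hlin _)
      (hnorm x ▸ hquad _)
  · have hVint := expIntegrable_of_lipschitzWith (brownianKernel δ w) hV (-a)
    rw [brownianKernel, integrable_map_measure (by fun_prop) (by fun_prop)] at hVint
    simpa only [Function.comp_def, neg_mul] using hVint
  · simpa only [hmul] using (hexp _).mul_const _

end BrownianKernel

section Gradient

variable {X : Type*} [NormedAddCommGroup X] [InnerProductSpace ℝ X] [CompleteSpace X]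
  {φ ψ : X → ℝ} {x : X}

lemma norm_fderiv_eq_norm_gradient (φ : X → ℝ) (x : X) : ‖fderiv ℝ φ x‖ = ‖gradient φ x‖ :=
  ((InnerProductSpace.toDual ℝ X).symm.norm_map _).symm

lemma gradient_fun_sub (hφ : DifferentiableAt ℝ φ x) (hψ : DifferentiableAt ℝ ψ x) :
    gradient (fun y => φ y - ψ y) x = gradient φ x - gradient ψ x := by
  unfold gradient
  rw [fderiv_fun_sub hφ hψ, map_sub]

lemma gradient_fun_const_mul (hφ : DifferentiableAt ℝ φ x) (θ : ℝ) :
    gradient (fun y => θ * φ y) x = θ • gradient φ x := by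
  unfold gradient
  rw [fderiv_const_mul hφ, map_smul]

lemma abs_sub_le_of_norm_gradient_le {w : X} {ε B : ℝ} (hφ : Differentiable ℝ φ) (hB : 0 ≤ B)
    (h : ∀ x, ‖gradient φ x‖ ≤ ε + B * ‖x - w‖) (x : X) :
    |φ x - φ w| ≤ (ε + B * ‖x - w‖) * ‖x - w‖ := by
  rw [← Real.norm_eq_abs]
  refine (convex_closedBall w ‖x - w‖).norm_image_sub_le_of_norm_fderiv_le (𝕜 := ℝ)
    (fun y _ => hφ y) (fun y hy => ?_) (by simp) (by simp [dist_eq_norm])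
  rw [mem_closedBall_iff_norm] at hy
  rw [norm_fderiv_eq_norm_gradient]
  exact (h y).trans (by gcongr)

/-- The functions `f t · y`, `y ∈ B`, are differentiable and their gradients are bounded and
uniformly continuous on `[0,1] × X × B`: the part of `HasRegularDerivs` that matters for
convergence. -/
structure HasUniformGradient {Y : Type*} [UniformSpace Y] (B : Set Y) (f : ℝ → X → Y → ℝ) :
    Prop where
  differentiable : ∀ t ∈ Icc (0 : ℝ) 1, ∀ y ∈ B, Differentiable ℝ (fun w => f t w y)
  bounded : ∃ C : ℝ, ∀ t ∈ Icc (0 : ℝ) 1, ∀ w : X, ∀ y ∈ B,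
    ‖gradient (fun w' => f t w' y) w‖ ≤ C
  uniform : UniformContinuousOn
    (fun q : ℝ × X × Y => gradient (fun w' => f q.1 w' q.2.2) q.2.1) (Icc 0 1 ×ˢ univ ×ˢ B)

lemma HasRegularDerivs.hasUniformGradient {k : ℕ} {Y : Type*} [UniformSpace Y] {B : Set Y}
    {f : ℝ → E k → Y → ℝ} (hf : HasRegularDerivs B f) : HasUniformGradient B f where
  differentiable t ht y hy := (hf.contDiff_space t ht y hy).differentiable two_ne_zero
  bounded := hf.bounded.imp fun _ hC t ht w y hy => (hC t ht w y hy).2.1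
  uniform := hf.uniform_gradient

namespace HasUniformGradient

variable {Y Z : Type*} [UniformSpace Y] [UniformSpace Z] {B : Set Y} {D : Set Z}
  {f g : ℝ → X → Y → ℝ}

lemma exists_lipschitzWith (hf : HasUniformGradient B f) :
    ∃ L : NNReal, ∀ t ∈ Icc (0 : ℝ) 1, ∀ y ∈ B, LipschitzWith L (fun w => f t w y) := by
  obtain ⟨C, hC⟩ := hf.bounded
  refine ⟨C.toNNReal, fun t ht y hy => lipschitzWith_of_nnnorm_fderiv_le (𝕜 := ℝ)
    (hf.differentiable t ht y hy) fun w => ?_⟩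
  rw [← NNReal.coe_le_coe, coe_nnnorm, norm_fderiv_eq_norm_gradient]
  exact (hC t ht w y hy).trans (Real.le_coe_toNNReal C)

lemma const_param {φ : ℝ → X → Z → ℝ} (hφ : HasUniformGradient D φ) {z : Z} (hz : z ∈ D)
    (B : Set Y) : HasUniformGradient B (fun t w _ => φ t w z) where
  differentiable t ht _ _ := hφ.differentiable t ht z hz
  bounded := hφ.bounded.imp fun _ hC t ht w _ _ => hC t ht w z hz
  uniform := hφ.uniform.comp (f := fun q : ℝ × X × Y => (q.1, q.2.1, z))
    (by fun_prop : UniformContinuous fun q : ℝ × X × Y => (q.1, q.2.1, z)).uniformContinuousOn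
    fun q hq => ⟨hq.1, hq.2.1, hz⟩

lemma const_mul (hf : HasUniformGradient B f) (θ : ℝ) :
    HasUniformGradient B (fun t w y => θ * f t w y) where
  differentiable t ht y hy := (hf.differentiable t ht y hy).const_mul θ
  bounded := by
    obtain ⟨C, hC⟩ := hf.bounded
    refine ⟨‖θ‖ * C, fun t ht w y hy => ?_⟩
    rw [gradient_fun_const_mul (hf.differentiable t ht y hy w), norm_smul]
    exact mul_le_mul_of_nonneg_left (hC t ht w y hy) (norm_nonneg θ)
  uniform := by
    refine ((uniformContinuous_const_smul θ).comp_uniformContinuousOn hf.uniform).congr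
      fun q hq => ?_
    exact (gradient_fun_const_mul (hf.differentiable _ hq.1 _ hq.2.2 _) θ).symm

lemma sub (hf : HasUniformGradient B f) (hg : HasUniformGradient B g) :
    HasUniformGradient B (fun t w y => f t w y - g t w y) where
  differentiable t ht y hy := (hf.differentiable t ht y hy).sub (hg.differentiable t ht y hy)
  bounded := by
    obtain ⟨C, hC⟩ := hf.bounded
    obtain ⟨C', hC'⟩ := hg.bounded
    refine ⟨C + C', fun t ht w y hy => ?_⟩
    rw [gradient_fun_sub (hf.differentiable t ht y hy w) (hg.differentiable t ht y hy w)]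
    exact (norm_sub_le _ _).trans (add_le_add (hC t ht w y hy) (hC' t ht w y hy))
  uniform := by
    have hsub := (uniformContinuousOn_iff_restrict.1 hf.uniform).sub
      (uniformContinuousOn_iff_restrict.1 hg.uniform)
    refine (uniformContinuousOn_iff_restrict (f := fun q : ℝ × X × Y =>
      gradient (fun w' => f q.1 w' q.2.2) q.2.1 - gradient (fun w' => g q.1 w' q.2.2) q.2.1).2
      hsub).congr fun q hq => ?_
    exact (gradient_fun_sub (hf.differentiable _ hq.1 _ hq.2.2 _)
      (hg.differentiable _ hq.1 _ hq.2.2 _)).symm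

lemma exists_norm_gradient_sub_le (hf : HasUniformGradient B f) {ε : ℝ} (hε : 0 < ε) :
    ∃ η > 0, ∃ K ≥ 0, ∀ t ∈ Icc (0 : ℝ) 1, ∀ t' ∈ Icc (0 : ℝ) 1, |t' - t| < η →
      ∀ w x : X, ∀ y ∈ B,
        ‖gradient (fun z => f t' z y) x - gradient (fun z => f t z y) w‖ ≤ ε + K * ‖x - w‖ := by
  obtain ⟨C, hC⟩ := hf.bounded
  obtain ⟨⟨r, r', N⟩, ⟨hr, hr', hN⟩, hunif⟩ :=
    ((Metric.uniformity_basis_dist.uniformity_prod (Metric.uniformity_basis_dist.uniformity_prod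
      (uniformity Y).basis_sets)).uniformContinuousOn_iff Metric.uniformity_basis_dist).1
        hf.uniform ε hε
  refine ⟨r, hr, 2 * |C| / r', by positivity, fun t ht t' ht' htt w x y hy => ?_⟩
  rcases lt_or_ge ‖x - w‖ r' with hnear | hfar
  · have hdist : dist (gradient (fun z => f t' z y) x) (gradient (fun z => f t z y) w) < ε :=
      hunif (t', x, y) ⟨ht', mem_univ _, hy⟩ (t, w, y) ⟨ht, mem_univ _, hy⟩
        ⟨htt, (dist_eq_norm x w).trans_lt hnear, refl_mem_uniformity hN⟩
    rw [dist_eq_norm] at hdist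
    exact hdist.le.trans (le_add_of_nonneg_right (by positivity))
  · have hgrad : ∀ t ∈ Icc (0 : ℝ) 1, ∀ w, ‖gradient (fun z => f t z y) w‖ ≤ |C| :=
      fun t ht w => (hC t ht w y hy).trans (le_abs_self C)
    calc ‖gradient (fun z => f t' z y) x - gradient (fun z => f t z y) w‖
        ≤ |C| + |C| := (norm_sub_le _ _).trans (add_le_add (hgrad t' ht' x) (hgrad t ht w))
      _ = 2 * |C| / r' * r' := by field_simp; ring
      _ ≤ ε + 2 * |C| / r' * ‖x - w‖ := by
        rw [← zero_add (2 * |C| / r' * r')]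
        gcongr

end HasUniformGradient

end Gradient

section Scheme

variable {k : ℕ} {Y : Type*} [UniformSpace Y] {γ c a : ℝ} {v : ℝ → E k → ℝ}
  {p : ℝ → E k → Y → ℝ} {A : Set Y}

/-- A family of value functions that is consistent in time under exponential utility with risk
aversion `a` along Brownian motion, and regular enough for one-step expansions. -/
structure IsUtilityFlow (a : ℝ) (B : Set Y) (f : ℝ → E k → Y → ℝ) : Prop where
  hasUniformGradient : HasUniformGradient B f
  expUtility_eq : ∀ t t' : ℝ, 0 ≤ t → t ≤ t' → t' ≤ 1 → ∀ w : E k, ∀ y ∈ B,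
    expUtility a (brownianKernel (t' - t) w) (fun x => f t' x y) = f t w y

lemma one_mem_unitInterval : (1 : ℝ) ∈ Icc (0 : ℝ) 1 := right_mem_Icc.2 zero_le_one

lemma HasUniformGradient.isUtilityFlow {B : Set Y} {f : ℝ → E k → Y → ℝ}
    (hf : HasUniformGradient B f) (hterminal : ∀ t w, ∀ y ∈ B,
      f t w y = expUtility a (brownianKernel (1 - t) w) (fun x => f 1 x y)) :
    IsUtilityFlow a B f where
  hasUniformGradient := hf
  expUtility_eq t t' _ htt' ht' w y hy := by
    obtain ⟨L, hL⟩ := hf.exists_lipschitzWith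
    simp only [fun x => hterminal t' x y hy]
    rw [expUtility_expUtility_brownianKernel a (sub_nonneg.2 htt') (sub_nonneg.2 ht') w
      (hL 1 one_mem_unitInterval y hy), sub_add_sub_cancel', ← hterminal t w y hy]

/-- The data of the Markovian sharing problem: at time `t` and state `w`, the supplier with risk
aversion `γ` values her position `y ∈ A` at `p t w y`, while `v t w` is the value of the whole
endowment for the representative agent, whose risk tolerance is the sum of those of the supplier
and of the demander. -/
structure IsSharingMarket (γ c : ℝ) (v : ℝ → E k → ℝ) (p : ℝ → E k → Y → ℝ) (A : Set Y) :
    Prop where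
  supplier_nonneg : 0 ≤ γ
  demander_nonneg : 0 ≤ c
  add_pos : 0 < c + γ
  representative : IsUtilityFlow (c * γ / (c + γ)) univ (fun t w (_ : Unit) => v t w)
  supplier : IsUtilityFlow γ A p

/-- Value of holding the position `u` between `t` and `t'` when the continuation value, with the
supplier's value of the position added, is `q`; the supplier's value is again added at time `t`. -/
noncomputable def positionValue (c : ℝ) (p : ℝ → E k → Y → ℝ) (t t' : ℝ) (q : E k → ℝ) (w : E k)
    (u : Y) : ℝ :=
  p t w u + expUtility c (brownianKernel (t' - t) w) (fun x => q x - p t' x u)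

/-- The dynamic programming operator from time `t'` to time `t`. -/
noncomputable def bellman (c : ℝ) (p : ℝ → E k → Y → ℝ) (A : Set Y) (t t' : ℝ) (q : E k → ℝ)
    (w : E k) : ℝ :=
  sSup (positionValue c p t t' q w '' A)

/-- Backward dynamic programming along the decreasing sequence of trading dates `τ`, started from
the representative agent's value. -/
noncomputable def schemeValue (c : ℝ) (v : ℝ → E k → ℝ) (p : ℝ → E k → Y → ℝ) (A : Set Y)
    (τ : ℕ → ℝ) : ℕ → E k → ℝ
  | 0 => v (τ 0)
  | m + 1 => bellman c p A (τ (m + 1)) (τ m) (schemeValue c v p A τ m)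

namespace IsSharingMarket

section Step

variable {t t' : ℝ} {q : E k → ℝ} {Q : NNReal} {u : Y}

lemma exists_lipschitzWith_representative (hm : IsSharingMarket γ c v p A) :
    ∃ L : NNReal, ∀ t ∈ Icc (0 : ℝ) 1, LipschitzWith L (v t) := by
  obtain ⟨L, hL⟩ := hm.representative.hasUniformGradient.exists_lipschitzWith
  exact ⟨L, fun t ht => hL t ht () (mem_univ _)⟩

lemma exists_lipschitzWith_supplier (hm : IsSharingMarket γ c v p A) :
    ∃ M : NNReal, ∀ t ∈ Icc (0 : ℝ) 1, ∀ u ∈ A, LipschitzWith M (fun w => p t w u) :=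
  hm.supplier.hasUniformGradient.exists_lipschitzWith

lemma positionValue_eq_aggregateUtility (hm : IsSharingMarket γ c v p A) (ht : 0 ≤ t)
    (htt' : t ≤ t') (ht' : t' ≤ 1) (hu : u ∈ A) (q : E k → ℝ) (w : E k) :
    positionValue c p t t' q w u =
      aggregateUtility γ c (brownianKernel (t' - t) w) q (fun x => p t' x u) := by
  rw [positionValue, aggregateUtility, hm.supplier.expUtility_eq t t' ht htt' ht' w u hu]

lemma positionValue_le (hm : IsSharingMarket γ c v p A) (ht : 0 ≤ t) (htt' : t ≤ t')
    (ht' : t' ≤ 1) (hu : u ∈ A) (hQ : LipschitzWith Q q) (hq : ∀ x, q x ≤ v t' x) (w : E k) :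
    positionValue c p t t' q w u ≤ v t w := by
  obtain ⟨L, hL⟩ := hm.exists_lipschitzWith_representative
  obtain ⟨M, hM⟩ := hm.exists_lipschitzWith_supplier
  have ht'I : t' ∈ Icc (0 : ℝ) 1 := ⟨ht.trans htt', ht'⟩
  have hexp : ∀ {K : NNReal} {f : E k → ℝ}, LipschitzWith K f →
      ExpIntegrable (brownianKernel (t' - t) w) f := expIntegrable_of_lipschitzWith _
  calc positionValue c p t t' q w u
      = aggregateUtility γ c (brownianKernel (t' - t) w) q (fun x => p t' x u) :=
        hm.positionValue_eq_aggregateUtility ht htt' ht' hu q w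
    _ ≤ expUtility (c * γ / (c + γ)) (brownianKernel (t' - t) w) q :=
        aggregateUtility_le hm.supplier_nonneg hm.demander_nonneg hm.add_pos (hexp hQ)
          (hexp (hM t' ht'I u hu))
    _ ≤ expUtility (c * γ / (c + γ)) (brownianKernel (t' - t) w) (v t') :=
        expUtility_mono (div_nonneg (mul_nonneg hm.demander_nonneg hm.supplier_nonneg)
          hm.add_pos.le) (hexp hQ) (hexp (hL t' ht'I)) hq
    _ = v t w := hm.representative.expUtility_eq t t' ht htt' ht' w () (mem_univ _)

lemma bddAbove_positionValue (hm : IsSharingMarket γ c v p A) (ht : 0 ≤ t) (htt' : t ≤ t')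
    (ht' : t' ≤ 1) (hQ : LipschitzWith Q q) (hq : ∀ x, q x ≤ v t' x) (w : E k) :
    BddAbove (positionValue c p t t' q w '' A) :=
  ⟨v t w, forall_mem_image.2 fun _ hu => hm.positionValue_le ht htt' ht' hu hQ hq w⟩

lemma bellman_le (hm : IsSharingMarket γ c v p A) (hA : A.Nonempty) (ht : 0 ≤ t) (htt' : t ≤ t')
    (ht' : t' ≤ 1) (hQ : LipschitzWith Q q) (hq : ∀ x, q x ≤ v t' x) (w : E k) :
    bellman c p A t t' q w ≤ v t w :=
  csSup_le (hA.image _)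
    (forall_mem_image.2 fun _ hu => hm.positionValue_le ht htt' ht' hu hQ hq w)

lemma exists_lipschitzWith_bellman (hm : IsSharingMarket γ c v p A) (hA : A.Nonempty)
    (ht : 0 ≤ t) (htt' : t ≤ t') (ht' : t' ≤ 1) (hQ : LipschitzWith Q q)
    (hq : ∀ x, q x ≤ v t' x) : ∃ Q' : NNReal, LipschitzWith Q' (bellman c p A t t' q) := by
  obtain ⟨M, hM⟩ := hm.exists_lipschitzWith_supplier
  refine ⟨M + (Q + M), LipschitzWith.of_le_add_mul _ fun w w' => csSup_le (hA.image _)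
    (forall_mem_image.2 fun u hu => ?_)⟩
  have hLip : LipschitzWith (M + (Q + M)) (fun w => positionValue c p t t' q w u) :=
    (hM t ⟨ht, htt'.trans ht'⟩ u hu).add (lipschitzWith_expUtility_brownianKernel
      hm.demander_nonneg _ (hQ.sub (hM t' ⟨ht.trans htt', ht'⟩ u hu)))
  have hdist := hLip.dist_le_mul w w'
  rw [Real.dist_eq] at hdist
  have hsup : positionValue c p t t' q w' u ≤ bellman c p A t t' q w' :=
    le_csSup (hm.bddAbove_positionValue ht htt' ht' hQ hq w') (mem_image_of_mem _ hu)
  linarith [(abs_le.1 hdist).2]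

lemma hasUniformGradient_remainder (hm : IsSharingMarket γ c v p A) :
    HasUniformGradient A fun t w u => p t w u - c / (c + γ) * v t w :=
  hm.supplier.hasUniformGradient.sub
    ((hm.representative.hasUniformGradient.const_param (mem_univ ()) A).const_mul (c / (c + γ)))

lemma gradient_remainder_eq_zero (hm : IsSharingMarket γ c v p A) (ht : t ∈ Icc (0 : ℝ) 1)
    (hu : u ∈ A) {w : E k}
    (h : gradient (fun x => p t x u) w = (c / (c + γ)) • gradient (v t) w) :
    gradient (fun x => p t x u - c / (c + γ) * v t x) w = 0 := by
  have hv : DifferentiableAt ℝ (v t) w :=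
    hm.representative.hasUniformGradient.differentiable t ht () (mem_univ _) w
  rw [gradient_fun_sub (hm.supplier.hasUniformGradient.differentiable t ht u hu w)
    (hv.const_mul _), gradient_fun_const_mul hv, h, sub_self]

lemma exists_sub_le_positionValue_of_norm_gradient_le (hm : IsSharingMarket γ c v p A) :
    ∃ C ≥ 0, ∀ t t' : ℝ, 0 ≤ t → t ≤ t' → t' ≤ 1 → ∀ w, ∀ u ∈ A, ∀ ε ≥ 0, ∀ B ≥ 0,
      (∀ x, ‖gradient (fun y => p t' y u - c / (c + γ) * v t' y) x‖ ≤ ε + B * ‖x - w‖) →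
      v t w - C * ((t' - t) * (ε + B * Real.sqrt (t' - t)) ^ 2) ≤
        positionValue c p t t' (v t') w u := by
  have hcγ := hm.add_pos
  have ha : 0 ≤ c * γ / (c + γ) :=
    div_nonneg (mul_nonneg hm.demander_nonneg hm.supplier_nonneg) hcγ.le
  obtain ⟨L, hL⟩ := hm.exists_lipschitzWith_representative
  obtain ⟨M, hM⟩ := hm.hasUniformGradient_remainder.exists_lipschitzWith
  refine ⟨(c + γ) * ((∫ x : E k, Real.exp ((c * γ / (c + γ) * L + (c + γ) * M + 4) * ‖x‖)
    ∂stdGaussian (E k)) / ∫ x : E k, Real.exp (-(c * γ / (c + γ) * L) * ‖x‖) ∂stdGaussian (E k)),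
    by positivity, fun t t' ht htt' ht' w u hu ε hε B hB hgrad => ?_⟩
  have ht'I : t' ∈ Icc (0 : ℝ) 1 := ⟨ht.trans htt', ht'⟩
  have hLip : LipschitzWith M fun y => p t' y u - c / (c + γ) * v t' y := hM t' ht'I u hu
  have hlin (x : E k) : |p t' x u - c / (c + γ) * v t' x - (p t' w u - c / (c + γ) * v t' w)| ≤
      M * ‖x - w‖ := hLip.norm_sub_le x w
  have hsecond := integral_tilted_brownianKernel_le (δ := t' - t) ha hcγ.le hε hB
    (sub_nonneg.2 htt') (by linarith) (hL t' ht'I) (hLip.continuous.measurable.sub_const _) hlin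
    (abs_sub_le_of_norm_gradient_le
      (hm.hasUniformGradient_remainder.differentiable t' ht'I u hu) hB hgrad)
  have hshare := sub_le_aggregateUtility (r := p t' w u - c / (c + γ) * v t' w)
    hm.supplier_nonneg hm.demander_nonneg hcγ
    (expIntegrable_of_lipschitzWith (brownianKernel (t' - t) w) (hL t' ht'I))
    ((expIntegrable_of_lipschitzWith _ hLip).sub
      (expIntegrable_const (p t' w u - c / (c + γ) * v t' w)))
    (F := fun x => p t' x u) (fun x => by ring)
  rw [hm.representative.expUtility_eq t t' ht htt' ht' w () (mem_univ _),
    ← hm.positionValue_eq_aggregateUtility ht htt' ht' hu] at hshare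
  refine le_trans ?_ hshare
  rw [mul_assoc]
  gcongr

lemma exists_sub_mul_le_positionValue (hm : IsSharingMarket γ c v p A)
    (hrep : ∀ t ∈ Icc (0 : ℝ) 1, ∀ w, ∃ u ∈ A,
      gradient (fun x => p t x u) w = (c / (c + γ)) • gradient (v t) w) {ε : ℝ} (hε : 0 < ε) :
    ∃ δ > 0, ∀ t t' : ℝ, 0 ≤ t → t ≤ t' → t' ≤ 1 → t' - t < δ → ∀ w, ∃ u ∈ A,
      v t w - ε * (t' - t) ≤ positionValue c p t t' (v t') w u := by
  obtain ⟨C, hC, hstep⟩ := hm.exists_sub_le_positionValue_of_norm_gradient_le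
  set ρ := Real.sqrt (ε / (4 * (C + 1))) with hρ_def
  have hρ : 0 < ρ := Real.sqrt_pos.2 (by positivity)
  have hρε : C * (2 * ρ) ^ 2 ≤ ε := by
    rw [mul_pow, hρ_def, Real.sq_sqrt (by positivity)]
    field_simp
    nlinarith
  obtain ⟨η, hη, K, hK, hgrad⟩ := hm.hasUniformGradient_remainder.exists_norm_gradient_sub_le hρ
  refine ⟨min η ((ρ / (K + 1)) ^ 2), by positivity, fun t t' ht htt' ht' hδ w => ?_⟩
  have htI : t ∈ Icc (0 : ℝ) 1 := ⟨ht, htt'.trans ht'⟩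
  obtain ⟨u, hu, hugrad⟩ := hrep t htI w
  refine ⟨u, hu, le_trans ?_ (hstep t t' ht htt' ht' w u hu ρ hρ.le K hK fun x => ?_)⟩
  · have hsqrt : K * Real.sqrt (t' - t) ≤ ρ := by
      have hle : Real.sqrt (t' - t) ≤ ρ / (K + 1) :=
        Real.sqrt_le_iff.2 ⟨by positivity, (hδ.trans_le (min_le_right _ _)).le⟩
      rw [le_div_iff₀ (by positivity)] at hle
      nlinarith [Real.sqrt_nonneg (t' - t)]
    have : 0 ≤ t' - t := sub_nonneg.2 htt'
    calc v t w - ε * (t' - t) ≤ v t w - C * (2 * ρ) ^ 2 * (t' - t) := by gcongr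
      _ = v t w - C * ((t' - t) * (ρ + ρ) ^ 2) := by ring
      _ ≤ v t w - C * ((t' - t) * (ρ + K * Real.sqrt (t' - t)) ^ 2) := by gcongr
  · have habs : |t' - t| < η := by
      rw [abs_of_nonneg (sub_nonneg.2 htt')]
      exact hδ.trans_le (min_le_left _ _)
    simpa only [hm.gradient_remainder_eq_zero htI hu hugrad, sub_zero] using
      hgrad t htI t' ⟨ht.trans htt', ht'⟩ habs w x u hu

end Step

section Convergence

variable {τ : ℕ → ℝ}

lemma exists_lipschitzWith_schemeValue_and_le (hm : IsSharingMarket γ c v p A) (hA : A.Nonempty)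
    (hτ : Antitone τ) (hτ0 : τ 0 ≤ 1) (m : ℕ) (hτm : 0 ≤ τ m) :
    (∃ Q : NNReal, LipschitzWith Q (schemeValue c v p A τ m)) ∧
      ∀ w, schemeValue c v p A τ m w ≤ v (τ m) w := by
  induction m with
  | zero =>
    obtain ⟨L, hL⟩ := hm.exists_lipschitzWith_representative
    exact ⟨⟨L, hL (τ 0) ⟨hτm, hτ0⟩⟩, fun _ => le_rfl⟩
  | succ m ih =>
    have hstep : τ (m + 1) ≤ τ m := hτ m.le_succ
    have hle : τ m ≤ 1 := (hτ m.zero_le).trans hτ0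
    obtain ⟨⟨Q, hQ⟩, hq⟩ := ih (hτm.trans hstep)
    exact ⟨hm.exists_lipschitzWith_bellman hA hτm hstep hle hQ hq,
      hm.bellman_le hA hτm hstep hle hQ hq⟩

lemma le_schemeValue_add (hm : IsSharingMarket γ c v p A) (hA : A.Nonempty) (hτ : Antitone τ)
    (hτ0 : τ 0 ≤ 1) {ε : ℝ} (hstep : ∀ m, 0 ≤ τ (m + 1) → ∀ w, ∃ u ∈ A,
      v (τ (m + 1)) w - ε * (τ m - τ (m + 1)) ≤
        positionValue c p (τ (m + 1)) (τ m) (v (τ m)) w u)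
    (m : ℕ) (hτm : 0 ≤ τ m) (w : E k) :
    v (τ m) w ≤ schemeValue c v p A τ m w + ε * (τ 0 - τ m) := by
  induction m generalizing w with
  | zero => simp [schemeValue]
  | succ m ih =>
    have hdec : τ (m + 1) ≤ τ m := hτ m.le_succ
    have hle : τ m ≤ 1 := (hτ m.zero_le).trans hτ0
    have hτmI : τ m ∈ Icc (0 : ℝ) 1 := ⟨hτm.trans hdec, hle⟩
    obtain ⟨L, hL⟩ := hm.exists_lipschitzWith_representative
    obtain ⟨M, hM⟩ := hm.exists_lipschitzWith_supplier
    obtain ⟨⟨Q, hQ⟩, hq⟩ :=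
      hm.exists_lipschitzWith_schemeValue_and_le hA hτ hτ0 m hτmI.1
    obtain ⟨u, hu, hloss⟩ := hstep m hτm w
    have hmono : positionValue c p (τ (m + 1)) (τ m) (v (τ m)) w u ≤
        positionValue c p (τ (m + 1)) (τ m) (schemeValue c v p A τ m) w u +
          ε * (τ 0 - τ m) := by
      rw [positionValue, positionValue, add_assoc]
      gcongr
      refine expUtility_le_add_of_le hm.demander_nonneg
        (expIntegrable_of_lipschitzWith _ ((hL _ hτmI).sub (hM _ hτmI u hu)))
        (expIntegrable_of_lipschitzWith _ (hQ.sub (hM _ hτmI u hu))) fun x => ?_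
      linarith [ih hτmI.1 x]
    have hsup : positionValue c p (τ (m + 1)) (τ m) (schemeValue c v p A τ m) w u ≤
        schemeValue c v p A τ (m + 1) w :=
      le_csSup (hm.bddAbove_positionValue hτm hdec hle hQ hq w) (mem_image_of_mem _ hu)
    linarith

end Convergence

end IsSharingMarket

end Scheme

/-- The date with `m` of `n` equal trading periods left. -/
noncomputable def gridTime (n m : ℕ) : ℝ := ((n : ℝ) - m) / n

lemma gridTime_antitone (n : ℕ) : Antitone (gridTime n) := fun m m' h => by
  unfold gridTime
  gcongr

lemma gridTime_self (n : ℕ) : gridTime n n = 0 := by rw [gridTime, sub_self, zero_div]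

lemma gridTime_zero {n : ℕ} (hn : 0 < n) : gridTime n 0 = 1 := by
  rw [gridTime, Nat.cast_zero, sub_zero, div_self (Nat.cast_ne_zero.2 hn.ne')]

lemma gridTime_nonneg {n m : ℕ} (h : m ≤ n) : 0 ≤ gridTime n m :=
  div_nonneg (sub_nonneg.2 (Nat.cast_le.2 h)) n.cast_nonneg

lemma gridTime_le_one (n m : ℕ) : gridTime n m ≤ 1 :=
  div_le_one_of_le₀ (sub_le_self _ m.cast_nonneg) n.cast_nonneg

lemma gridTime_sub_gridTime_succ (n m : ℕ) :
    gridTime n m - gridTime n (m + 1) = 1 / (n : ℝ) := by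
  rw [gridTime, gridTime, Nat.cast_succ, ← sub_div]
  ring

lemma gridTime_succ_lt {n : ℕ} (hn : 0 < n) (m : ℕ) : gridTime n (m + 1) < gridTime n m :=
  sub_pos.1 <| by rw [gridTime_sub_gridTime_succ]; positivity

section Convergence

variable {k : ℕ} {Y : Type*} [UniformSpace Y] {γ c : ℝ} {v : ℝ → E k → ℝ}
  {p : ℝ → E k → Y → ℝ} {A : Set Y}

lemma IsSharingMarket.tendsto_schemeValue (hm : IsSharingMarket γ c v p A) (hA : A.Nonempty)
    (hrep : ∀ t ∈ Icc (0 : ℝ) 1, ∀ w, ∃ u ∈ A,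
      gradient (fun x => p t x u) w = (c / (c + γ)) • gradient (v t) w) (w : E k) :
    Tendsto (fun n => schemeValue c v p A (gridTime n) n w) atTop (𝓝 (v 0 w)) := by
  rw [Metric.tendsto_atTop]
  intro ε hε
  obtain ⟨δ, hδ, hloss⟩ := hm.exists_sub_mul_le_positionValue hrep (half_pos hε)
  obtain ⟨N, hN⟩ := exists_nat_one_div_lt hδ
  refine ⟨N + 1, fun n hn => ?_⟩
  have hmesh : 1 / (n : ℝ) < δ := by
    refine lt_of_le_of_lt ?_ hN
    gcongr
    exact_mod_cast hn
  have hlower := hm.le_schemeValue_add hA (gridTime_antitone n) (gridTime_le_one n 0)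
    (fun m hτ => hloss _ _ hτ (gridTime_antitone n m.le_succ) (gridTime_le_one n m)
      ((gridTime_sub_gridTime_succ n m).trans_lt hmesh)) n (gridTime_nonneg le_rfl) w
  have hupper := (hm.exists_lipschitzWith_schemeValue_and_le hA (gridTime_antitone n)
    (gridTime_le_one n 0) n (gridTime_nonneg le_rfl)).2 w
  rw [gridTime_self] at hlower hupper
  rw [gridTime_zero (by omega)] at hlower
  rw [Real.dist_eq, abs_lt]
  constructor <;> linarith

end Convergence

section Market

variable {k d : ℕ} {γ c : ℝ} {s : E k → E d} {g h : E k → ℝ} {A : Set (E d)}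

lemma vFun_one (w : E k) : vFun γ c g h 1 w = g w + h w := by
  rw [vFun, sub_self, brownianKernel_zero, expUtility_dirac]

lemma pFun_one (w : E k) (y : E d) : pFun γ g s 1 w y = g w - inner ℝ y (s w) := by
  rw [pFun, sub_self, brownianKernel_zero, expUtility_dirac]

lemma isSharingMarket_vFun_pFun (hγ : 0 ≤ γ) (hc : 0 ≤ c) (hcγ : 0 < c + γ)
    (hv : HasUniformGradient univ fun t w (_ : Unit) => vFun γ c g h t w)
    (hp : HasUniformGradient A (pFun γ g s)) :
    IsSharingMarket γ c (vFun γ c g h) (pFun γ g s) A where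
  supplier_nonneg := hγ
  demander_nonneg := hc
  add_pos := hcγ
  representative := hv.isUtilityFlow fun t w _ _ => by simp only [vFun_one]; rfl
  supplier := hp.isUtilityFlow fun t w y _ => by simp only [pFun_one]; rfl

end Market

section Conditioning

variable {Ω : Type*} [mΩ : MeasurableSpace Ω] {P : Measure Ω} {𝓕 : Filtration ℝ mΩ}
  {κ : ℝ → Ω → Measure Ω} {t : ℝ}

lemma IsRegularCondProb.ae_ae_of_ae (hκ : IsRegularCondProb P 𝓕 κ) (ht : t ∈ Ico (0 : ℝ) 1)
    {φ : Ω → Prop} (hφ : ∀ᵐ ω ∂P, φ ω) : ∀ᵐ ω ∂P, ∀ᵐ ω' ∂(κ t ω), φ ω' := by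
  set N := toMeasurable P {ω | ¬φ ω}
  have hN : P N = 0 := by rw [measure_toMeasurable]; exact ae_iff.1 hφ
  have hzero : P[N.indicator (fun _ => (1 : ℝ)) | 𝓕 t] =ᵐ[P] 0 := by
    simpa only [condExp_zero] using condExp_congr_ae (m := 𝓕 t)
      (indicator_meas_zero hN : N.indicator (fun _ => (1 : ℝ)) =ᵐ[P] 0)
  filter_upwards [(hκ.condExp t ht N (measurableSet_toMeasurable _ _)).trans hzero] with ω hω
  have := hκ.isProbabilityMeasure t ht ω
  rw [Pi.zero_apply, measureReal_eq_zero_iff] at hω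
  exact ae_iff.2 (measure_mono_null (subset_toMeasurable _ _) hω)

section CountablyGenerated

variable {β : Type*} [mβ : MeasurableSpace β] [MeasurableSpace.CountablyGenerated β] {X : Ω → β}

lemma IsRegularCondProb.ae_map_eq (hκ : IsRegularCondProb P 𝓕 κ) (ht : t ∈ Ico (0 : ℝ) 1)
    (hX : Measurable X) {ν : Ω → Measure β} (hν : ∀ ω, IsProbabilityMeasure (ν ω))
    (h : ∀ B : Set β, MeasurableSet B →
      P[(X ⁻¹' B).indicator (fun _ => (1 : ℝ)) | 𝓕 t] =ᵐ[P] fun ω => (ν ω).real B) :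
    ∀ᵐ ω ∂P, (κ t ω).map X = ν ω := by
  obtain ⟨b, hbc, hb⟩ := MeasurableSpace.CountablyGenerated.isCountablyGenerated (α := β)
  have hgen : mβ = MeasurableSpace.generateFrom (generateSetAlgebra b) := by
    rw [generateFrom_generateSetAlgebra_eq, ← hb]
  have hmeas : ∀ B ∈ generateSetAlgebra b, MeasurableSet B := fun B hB => by
    rw [hgen]; exact MeasurableSpace.measurableSet_generateFrom hB
  have hall : ∀ᵐ ω ∂P, ∀ B ∈ generateSetAlgebra b, (κ t ω).real (X ⁻¹' B) = (ν ω).real B := by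
    rw [ae_ball_iff (countable_generateSetAlgebra hbc)]
    intro B hB
    exact (hκ.condExp t ht _ (hX (hmeas B hB))).trans (h B (hmeas B hB))
  filter_upwards [hall] with ω hω
  have := hκ.isProbabilityMeasure t ht ω
  have := hν ω
  have := Measure.isProbabilityMeasure_map (μ := κ t ω) hX.aemeasurable
  refine ext_of_generate_finite _ hgen
    isSetAlgebra_generateSetAlgebra.isSetRing.isSetSemiring.isPiSystem (fun B hB => ?_) (by simp)
  rw [Measure.map_apply hX (hmeas B hB)]
  exact (measureReal_eq_measureReal_iff).1 (hω B hB)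

lemma IsRegularCondProb.ae_map_eq_dirac [IsProbabilityMeasure P] (hκ : IsRegularCondProb P 𝓕 κ)
    (ht : t ∈ Ico (0 : ℝ) 1) (hX : Measurable[𝓕 t] X) :
    ∀ᵐ ω ∂P, (κ t ω).map X = Measure.dirac (X ω) := by
  have hX' : Measurable X := hX.mono (𝓕.le t) le_rfl
  refine hκ.ae_map_eq ht hX' (fun _ => inferInstance) fun B hB => ?_
  rw [condExp_of_stronglyMeasurable (𝓕.le t) (stronglyMeasurable_const.indicator (hX hB))
    ((integrable_const _).indicator (hX' hB))]
  refine ae_of_all _ fun ω => ?_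
  by_cases hω : X ω ∈ B <;> simp [Measure.real, Measure.dirac_apply' _ hB, hω]

lemma IsRegularCondProb.ae_map_eq_of_indep [IsProbabilityMeasure P]
    (hκ : IsRegularCondProb P 𝓕 κ) (ht : t ∈ Ico (0 : ℝ) 1) (hX : Measurable X)
    (hind : Indep (MeasurableSpace.comap X mβ) (𝓕 t) P) :
    ∀ᵐ ω ∂P, (κ t ω).map X = P.map X := by
  refine hκ.ae_map_eq ht hX (fun _ => Measure.isProbabilityMeasure_map hX.aemeasurable)
    fun B hB => ?_
  refine (condExp_indep_eq hX.comap_le (𝓕.le t)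
    (stronglyMeasurable_const.indicator ⟨B, hB, rfl⟩) hind).trans (ae_of_all _ fun ω => ?_)
  simp only [Measure.real]
  rw [Measure.map_apply hX hB, integral_indicator (hX hB)]
  simp [Measure.real]

end CountablyGenerated

namespace IsBrownianMotion

variable {k : ℕ} {W : ℝ → Ω → E k}

lemma measurable (hW : IsBrownianMotion P 𝓕 W) (ht : t ∈ Icc (0 : ℝ) 1) : Measurable (W t) :=
  (hW.adapted t ht).mono (𝓕.le t) le_rfl

lemma ae_ae_eq [IsProbabilityMeasure P] (hW : IsBrownianMotion P 𝓕 W)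
    (hκ : IsRegularCondProb P 𝓕 κ) (ht : t ∈ Ico (0 : ℝ) 1) :
    ∀ᵐ ω ∂P, ∀ᵐ ω' ∂(κ t ω), W t ω' = W t ω := by
  have htI : t ∈ Icc (0 : ℝ) 1 := Ico_subset_Icc_self ht
  filter_upwards [hκ.ae_map_eq_dirac ht (hW.adapted t htI)] with ω hω
  have hdirac : ∀ᵐ x ∂((κ t ω).map (W t)), x = W t ω := by rw [hω, ae_dirac_eq]; rfl
  exact ae_of_ae_map (hW.measurable htI).aemeasurable hdirac

lemma ae_map_eq_brownianKernel [IsProbabilityMeasure P] (hW : IsBrownianMotion P 𝓕 W)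
    (hκ : IsRegularCondProb P 𝓕 κ) (ht : t ∈ Ico (0 : ℝ) 1) {t' : ℝ} (htt' : t ≤ t')
    (ht' : t' ≤ 1) : ∀ᵐ ω ∂P, (κ t ω).map (W t') = brownianKernel (t' - t) (W t ω) := by
  have hincr : Measurable (fun ω => W t' ω - W t ω) :=
    (hW.measurable ⟨ht.1.trans htt', ht'⟩).sub (hW.measurable (Ico_subset_Icc_self ht))
  filter_upwards [hW.ae_ae_eq hκ ht,
    hκ.ae_map_eq_of_indep ht hincr (hW.indep t t' ht.1 htt' ht')] with ω hnow hlaw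
  calc (κ t ω).map (W t')
      = (κ t ω).map (fun ω' => W t ω + (W t' ω' - W t ω')) :=
        Measure.map_congr (hnow.mono fun ω' hω' => by simp only [hω', add_sub_cancel])
    _ = ((κ t ω).map (fun ω' => W t' ω' - W t ω')).map (fun x => W t ω + x) :=
        (Measure.map_map (by fun_prop) hincr).symm
    _ = brownianKernel (t' - t) (W t ω) := by
        rw [hlaw, hW.law t t' ht.1 htt' ht', map_const_add_brownianKernel, add_zero]

end IsBrownianMotion

end Conditioning

section DynamicProgramming

lemma sInf_setOf_le_add (a b : ℝ) : sInf {q : ℝ | a ≤ b + q} = a - b := by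
  have hIci : {q : ℝ | a ≤ b + q} = Ici (a - b) := by
    ext q
    exact (sub_le_iff_le_add' (a := a) (b := b) (c := q)).symm
  rw [hIci, csInf_Ici]

lemma sSup_image_setOf_sub_mem {V : Type*} [AddGroup V] {A : Set V} (hA : A.Nonempty) {f F : V → ℝ}
    (hf : BddAbove (f '' A)) {z : V} {r : ℝ} (hF : ∀ y, y - z ∈ A → F y = r + f (y - z)) :
    sSup (F '' {y | y - z ∈ A}) = r + sSup (f '' A) := by
  have himage : F '' {y | y - z ∈ A} = (fun x => r + x) '' (f '' A) := by
    rw [image_congr (s := {y | y - z ∈ A}) hF, image_image]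
    ext x
    constructor
    · rintro ⟨y, hy, rfl⟩
      exact ⟨y - z, hy, rfl⟩
    · rintro ⟨u, hu, rfl⟩
      exact ⟨u + z, by simpa using hu, by simp only [add_sub_cancel_right]⟩
  rw [himage]
  exact ((OrderIso.addLeft r).map_csSup' (hA.image f) hf).symm

variable {Ω : Type*} [mΩ : MeasurableSpace Ω] {P : Measure Ω} {𝓕 : Filtration ℝ mΩ}
  {κ : ℝ → Ω → Measure Ω} {k d : ℕ} {W : ℝ → Ω → E k} {γ c t t' : ℝ} {ω : Ω}

lemma condUtility_eq_expUtility_brownianKernel_add {X : Ω → E k} (hX : Measurable X) {r : ℝ}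
    {w : E k} (hlaw : (κ t ω).map X = brownianKernel r w) {f : E k → ℝ} {L : NNReal}
    (hf : LipschitzWith L f) {F : Ω → ℝ} {b : ℝ} (hF : F =ᵐ[κ t ω] fun ω' => f (X ω') + b)
    (a : ℝ) : condUtility κ a t F ω = expUtility a (brownianKernel r w) f + b := by
  rw [condUtility, expUtility_congr a hF,
    ← expUtility_add_const a b (expIntegrable_of_lipschitzWith _ hf), ← hlaw,
    expUtility_map a hX.aemeasurable (hf.continuous.measurable.add_const b).aemeasurable]

lemma condUtility_eq_add_positionValue {Y : Type*} {p : ℝ → E k → Y → ℝ} {q : E k → ℝ}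
    {M Q : NNReal} {u u₀ : Y} {F : Ω → ℝ} {x : ℝ} (hWt' : Measurable (W t'))
    (hnow : ∀ᵐ ω' ∂(κ t ω), W t ω' = W t ω)
    (hlaw : (κ t ω).map (W t') = brownianKernel (t' - t) (W t ω)) (hq : LipschitzWith Q q)
    (hp : LipschitzWith M (fun w => p t' w u))
    (hF : ∀ᵐ ω' ∂(κ t ω), F ω' =
      x - (p t (W t ω') u₀ - p t (W t ω') u) - p t' (W t' ω') u + q (W t' ω')) :
    condUtility κ c t F ω = x - p t (W t ω) u₀ + positionValue c p t t' q (W t ω) u := by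
  have hF' : F =ᵐ[κ t ω] fun ω' => q (W t' ω') - p t' (W t' ω') u +
      (x - p t (W t ω) u₀ + p t (W t ω) u) := by
    filter_upwards [hnow, hF] with ω' hω' hFω'
    rw [hFω', hω']
    ring
  rw [condUtility_eq_expUtility_brownianKernel_add hWt' hlaw (hq.sub hp) hF', positionValue]
  ring

variable {s : E k → E d} {g h : E k → ℝ} {A : Set (E d)} {G H : Ω → ℝ} {S : Ω → E d}

lemma condUtility_eq_pFun_add (hp : HasUniformGradient A (pFun γ g s)) (hW1 : Measurable (W 1))
    (hlaw : (κ t ω).map (W 1) = brownianKernel (1 - t) (W t ω)) {u : E d} (hu : u ∈ A) {F : Ω → ℝ}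
    {b : ℝ} (hF : ∀ ω, F ω = g (W 1 ω) - inner ℝ u (s (W 1 ω)) + b) :
    condUtility κ γ t F ω = pFun γ g s t (W t ω) u + b := by
  obtain ⟨M, hM⟩ := hp.exists_lipschitzWith
  have hLip : LipschitzWith M (fun x => g x - inner ℝ u (s x)) := by
    simpa only [pFun_one] using hM 1 one_mem_unitInterval u hu
  exact condUtility_eq_expUtility_brownianKernel_add hW1 hlaw hLip (ae_of_all _ hF) γ

lemma condUtility_eq_vFun (hv : HasUniformGradient univ fun t w (_ : Unit) => vFun γ c g h t w)
    (hW1 : Measurable (W 1)) (hlaw : (κ t ω).map (W 1) = brownianKernel (1 - t) (W t ω)) :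
    condUtility κ (c * γ / (c + γ)) t (fun ω' => g (W 1 ω') + h (W 1 ω')) ω =
      vFun γ c g h t (W t ω) := by
  obtain ⟨L, hL⟩ := hv.exists_lipschitzWith
  have hLip : LipschitzWith L (fun x => g x + h x) := by
    simpa only [vFun_one] using hL 1 one_mem_unitInterval () (mem_univ _)
  rw [condUtility_eq_expUtility_brownianKernel_add (b := 0) hW1 hlaw hLip
    (ae_of_all _ fun _ => (add_zero _).symm), add_zero, vFun]

lemma price_eq_pFun_sub_pFun (hS : S = fun ω => s (W 1 ω)) (hG : G = fun ω => g (W 1 ω))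
    (hp : HasUniformGradient A (pFun γ g s)) (hW1 : Measurable (W 1))
    (hlaw : (κ t ω).map (W 1) = brownianKernel (1 - t) (W t ω)) {z y : E d} (hz : -z ∈ A)
    (hy : y - z ∈ A) :
    price κ γ G S t z y ω = pFun γ g s t (W t ω) (-z) - pFun γ g s t (W t ω) (y - z) := by
  have hbefore : condUtility κ γ t (fun ω' => G ω' + inner ℝ z (S ω')) ω =
      pFun γ g s t (W t ω) (-z) := by
    rw [condUtility_eq_pFun_add (b := 0) hp hW1 hlaw hz fun ω' => ?_, add_zero]
    simp only [hG, hS, inner_neg_left]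
    ring
  have hafter (q : ℝ) :
      condUtility κ γ t (fun ω' => G ω' + inner ℝ z (S ω') - inner ℝ y (S ω') + q) ω =
        pFun γ g s t (W t ω) (y - z) + q :=
    condUtility_eq_pFun_add hp hW1 hlaw hy fun ω' => by
      simp only [hG, hS, inner_sub_left]
      ring
  simp only [price, hbefore, hafter]
  exact sInf_setOf_le_add _ _

lemma dpRemaining_succ (n m : ℕ) (x : ℝ) (z : E d) (ω : Ω) :
    dpRemaining κ γ c A G H S n (m + 1) x z ω =
      sSup ((fun y : E d => condUtility κ c (gridTime n (m + 1))
        (fun ω' => dpRemaining κ γ c A G H S n m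
          (x - price κ γ G S (gridTime n (m + 1)) z y ω') (z - y) ω') ω) ''
        {y : E d | y - z ∈ A}) := by
  simp only [dpRemaining, gridTime, Nat.cast_succ]

lemma ae_dpRemaining_eq [IsProbabilityMeasure P] (hκ : IsRegularCondProb P 𝓕 κ)
    (hW : IsBrownianMotion P 𝓕 W) (hS : S = fun ω => s (W 1 ω)) (hG : G = fun ω => g (W 1 ω))
    (hH : H = fun ω => h (W 1 ω)) (hA : A.Nonempty)
    (hm : IsSharingMarket γ c (vFun γ c g h) (pFun γ g s) A) {n : ℕ} (hn : 0 < n) (m : ℕ)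
    (hmn : m ≤ n) :
    ∀ᵐ ω ∂P, ∀ x : ℝ, ∀ z : E d, -z ∈ A → dpRemaining κ γ c A G H S n m x z ω =
      x - pFun γ g s (gridTime n m) (W (gridTime n m) ω) (-z) +
        schemeValue c (vFun γ c g h) (pFun γ g s) A (gridTime n) m (W (gridTime n m) ω) := by
  induction m with
  | zero =>
    refine ae_of_all _ fun ω x z _ => ?_
    simp only [dpRemaining, schemeValue, gridTime_zero hn, vFun_one, pFun_one, hS, hH,
      inner_neg_left]
    ring
  | succ m ih =>
    set t := gridTime n (m + 1)
    set t' := gridTime n m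
    have htt' : t < t' := gridTime_succ_lt hn m
    have ht' : t' ∈ Icc (0 : ℝ) 1 := ⟨gridTime_nonneg (by omega), gridTime_le_one n m⟩
    have ht : t ∈ Ico (0 : ℝ) 1 := ⟨gridTime_nonneg hmn, htt'.trans_le ht'.2⟩
    have hW1 : Measurable (W 1) := hW.measurable one_mem_unitInterval
    obtain ⟨M, hM⟩ := hm.exists_lipschitzWith_supplier
    obtain ⟨⟨Q, hQ⟩, hq⟩ := hm.exists_lipschitzWith_schemeValue_and_le hA (gridTime_antitone n)
      (gridTime_le_one n 0) m ht'.1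
    filter_upwards [hW.ae_ae_eq hκ ht, hW.ae_map_eq_brownianKernel hκ ht htt'.le ht'.2,
      hκ.ae_ae_of_ae ht (ih (by omega)),
      hκ.ae_ae_of_ae ht (hW.ae_map_eq_brownianKernel hκ ht ht.2.le le_rfl)]
      with ω hnow hlaw hnext hlaw1 x z hz
    rw [dpRemaining_succ]
    refine sSup_image_setOf_sub_mem hA
      (hm.bddAbove_positionValue ht.1 htt'.le ht'.2 hQ hq (W t ω)) fun y hy => ?_
    refine condUtility_eq_add_positionValue (hW.measurable ht') hnow hlaw hQ (hM t' ht' _ hy) ?_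
    filter_upwards [hnext, hlaw1] with ω' hnextω' hlaw1ω'
    rw [hnextω' _ (z - y) (by rwa [neg_sub]),
      price_eq_pFun_sub_pFun hS hG hm.supplier.hasUniformGradient hW1 hlaw1ω' hz hy, neg_sub]

lemma ae_dpValue_zero_eq [IsProbabilityMeasure P] (hκ : IsRegularCondProb P 𝓕 κ)
    (hW : IsBrownianMotion P 𝓕 W) (hS : S = fun ω => s (W 1 ω)) (hG : G = fun ω => g (W 1 ω))
    (hH : H = fun ω => h (W 1 ω)) (hA0 : (0 : E d) ∈ A)
    (hm : IsSharingMarket γ c (vFun γ c g h) (pFun γ g s) A) :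
    ∀ᵐ ω ∂P, ∀ n : ℕ, 0 < n → dpValue κ γ c A G H S n 0 0 0 ω =
      schemeValue c (vFun γ c g h) (pFun γ g s) A (gridTime n) n (W 0 ω) -
        pFun γ g s 0 (W 0 ω) 0 := by
  refine ae_all_iff.2 fun n => eventually_imp_distrib_left.2 fun hn => ?_
  filter_upwards [ae_dpRemaining_eq hκ hW hS hG hH ⟨0, hA0⟩ hm hn n le_rfl] with ω hω
  rw [dpValue, mul_zero, Nat.floor_zero, Nat.sub_zero, hω 0 0 (by rwa [neg_zero]), gridTime_self,
    neg_zero]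
  ring

lemma ae_vFun_sub_pFun_eq [IsProbabilityMeasure P] (hκ : IsRegularCondProb P 𝓕 κ)
    (hW : IsBrownianMotion P 𝓕 W) (hG : G = fun ω => g (W 1 ω)) (hH : H = fun ω => h (W 1 ω))
    (hA0 : (0 : E d) ∈ A) (hm : IsSharingMarket γ c (vFun γ c g h) (pFun γ g s) A) :
    ∀ᵐ ω ∂P, vFun γ c g h 0 (W 0 ω) - pFun γ g s 0 (W 0 ω) 0 =
      condUtility κ (c * γ / (c + γ)) 0 (fun ω' => G ω' + H ω') ω - condUtility κ γ 0 G ω := by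
  filter_upwards [hW.ae_map_eq_brownianKernel hκ ⟨le_rfl, one_pos⟩ zero_le_one le_rfl] with ω hlaw
  have hW1 : Measurable (W 1) := hW.measurable one_mem_unitInterval
  rw [condUtility_eq_pFun_add (b := 0) hm.supplier.hasUniformGradient hW1 hlaw hA0 (by simp [hG]),
    add_zero, hG, hH, condUtility_eq_vFun hm.representative.hasUniformGradient hW1 hlaw]

end DynamicProgramming

end IndifferencePricing

open IndifferencePricing in
theorem mainTheorem4_general {Ω : Type*} [mΩ : MeasurableSpace Ω] (P : Measure Ω)
    [IsProbabilityMeasure P] (𝓕 : Filtration ℝ mΩ) (κ : ℝ → Ω → Measure Ω)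
    (hκ : IsRegularCondProb P 𝓕 κ) {k d : ℕ} (W : ℝ → Ω → E k) (hW : IsBrownianMotion P 𝓕 W)
    (γ c : ℝ) (hγ : 0 ≤ γ) (hc : 0 ≤ c) (hcγ : 0 < c + γ) (s : E k → E d) (g h : E k → ℝ)
    (S : Ω → E d) (G H : Ω → ℝ)
    (hS : S = fun ω => s (W 1 ω)) (hG : G = fun ω => g (W 1 ω)) (hH : H = fun ω => h (W 1 ω))
    (A : Set (E d)) (hA0 : (0 : E d) ∈ A)
    (hv : HasUniformGradient Set.univ (fun t w (_ : Unit) => vFun γ c g h t w))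
    (hp : HasUniformGradient A (pFun γ g s))
    (hgrad : ∀ t ∈ Set.Icc (0 : ℝ) 1, ∀ w : E k, ∃ u ∈ A,
      gradient (fun w' => pFun γ g s t w' u) w = (c / (c + γ)) • gradient (vFun γ c g h t) w) :
    ∀ᵐ ω ∂P,
      Tendsto (fun n : ℕ => dpValue κ γ c A G H S n 0 0 0 ω) atTop
        (𝓝 (vFun γ c g h 0 (W 0 ω) - pFun γ g s 0 (W 0 ω) 0)) ∧
      vFun γ c g h 0 (W 0 ω) - pFun γ g s 0 (W 0 ω) 0 =
        condUtility κ (c * γ / (c + γ)) 0 (fun ω' => G ω' + H ω') ω - condUtility κ γ 0 G ω := by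
  have hm : IsSharingMarket γ c (vFun γ c g h) (pFun γ g s) A :=
    isSharingMarket_vFun_pFun hγ hc hcγ hv hp
  filter_upwards [ae_dpValue_zero_eq hκ hW hS hG hH hA0 hm, ae_vFun_sub_pFun_eq hκ hW hG hH hA0 hm]
    with ω hdp hcond
  refine ⟨((hm.tendsto_schemeValue ⟨0, hA0⟩ hgrad (W 0 ω)).sub_const _).congr' ?_, hcond⟩
  filter_upwards [eventually_gt_atTop 0] with n hn
  exact (hdp n hn).symm

open IndifferencePricing in
theorem mainTheorem4 {Ω : Type*} [mΩ : MeasurableSpace Ω] (P : Measure Ω) [IsProbabilityMeasure P]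
    (𝓕 : Filtration ℝ mΩ) (κ : ℝ → Ω → Measure Ω) (hκ : IsRegularCondProb P 𝓕 κ)
    {k d : ℕ} (W : ℝ → Ω → E k) (hW : IsBrownianMotion P 𝓕 W)
    (γ c : ℝ) (hγ : 0 ≤ γ) (hc : 0 ≤ c) (hcγ : 0 < c + γ)
    (s : E k → E d) (g h : E k → ℝ) (hs : Measurable s) (hg : Measurable g) (hh : Measurable h)
    (S : Ω → E d) (G H : Ω → ℝ)
    (hS : S = fun ω => s (W 1 ω)) (hG : G = fun ω => g (W 1 ω)) (hH : H = fun ω => h (W 1 ω))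
    (hSexp : HasExpMoments P S) (hGexp : HasExpMoments P G) (hHexp : HasExpMoments P H)
    (A : Set (E d)) (hA : IsCompact A) (hA0 : (0 : E d) ∈ A)
    (hv : HasRegularDerivs (Set.univ : Set Unit) (fun t w _ => vFun γ c g h t w))
    (hp : HasRegularDerivs A (pFun γ g s))
    (yd : E k × ℝ × E k → E d) (hyd : IsCompletenessMap γ g s yd)
    (hAyd : ∀ t ∈ Set.Icc (0 : ℝ) 1, ∀ w : E k,
      yd (w, t, -((c / (c + γ)) • gradient (vFun γ c g h t) w)) ∈ A) :
    ∀ᵐ ω ∂P,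
      Tendsto (fun n : ℕ => dpValue κ γ c A G H S n 0 0 0 ω) atTop
        (𝓝 (vFun γ c g h 0 (W 0 ω) - pFun γ g s 0 (W 0 ω) 0)) ∧
      vFun γ c g h 0 (W 0 ω) - pFun γ g s 0 (W 0 ω) 0 =
        condUtility κ (c * γ / (c + γ)) 0 (fun ω' => G ω' + H ω') ω - condUtility κ γ 0 G ω := by
  refine mainTheorem4_general P 𝓕 κ hκ W hW γ c hγ hc hcγ s g h S G H hS hG hH A hA0
    hv.hasUniformGradient hp.hasUniformGradient fun t ht w => ⟨_, hAyd t ht w, ?_⟩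
  rw [(hyd.hasGradientAt _ t ht w).gradient, neg_neg]
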